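/- Let $G$ be a matrix Lie group, i.e. a closed subgroup of $\mathrm{GL}(n,\mathbb R)$ or $\mathrm{GL}(n,\mathbb C)$ regarded as a real Lie group, with Lie algebra $T_eG$ identified with a space of matrices, and equip $G$ with a bi-invariant Riemannian metric. Let $H\subseteq G$ be a closed subgroup, and let $M=G/H$ be the homogeneous space with its usual smooth structure (for which $\pi:G\to G/H$ is a smooth submersion), its left $G$-action, and the Riemannian metric induced from $G$, i.e. the one for which $d\pi_g$ maps $(\ker d\pi_g)^{\perp}$ isometrically onto $T_{\pi(g)}M$ for every $g\in G$. Let $\mathrm{dist}$ be the Riemannian distance of $M$, that is, the infimum of the lengths of $C^1$ curves ($+\infty$ for points in different components). For $p\in M$ call $A\in T_eG$ horizontal at $p$ if it is orthogonal to the kernel of the derivative at $e$ of the orbit map $g\mapsto g\,p$; a tangent vector $X\in T_pM$ is identified with the horizontal $A\in T_eG$ that this derivative maps to $X$, and $\exp(-X)p$ stands for $\exp_{\mathrm M}(-A)\,p$, where $\exp_{\mathrm M}$ is the matrix exponential. Then, for all $p,q\in M$ and $\Phi\in G$: (i) $\mathrm{dist}(\Phi p,\Phi q)\le \mathrm{dist}(p,q)$.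 (ii) Let $X=\log_p(q)\in T_pM$ be the initial velocity of a length-minimizing geodesic $[0,1]\to M$ of constant speed from $p$ to $q$ (if that geodesic is not unique, the initial velocity of any of them). Then the horizontal $A\in T_eG$ representing $X$ exists, $\exp_{\mathrm M}(-A)\in G$, and for $\hat q=\exp(-X)p=\exp_{\mathrm M}(-A)\,p$ there is a length-minimizing geodesic $[0,1]\to M$ of constant speed from $p$ to $\hat q$ with initial velocity $-X$ (so that $\hat q=\exp_p(-X)$ is also the Riemannian exponential), and $$\mathrm{dist}(\Phi p,\Phi q)=\mathrm{dist}(\Phi p,\Phi\hat q).$$ -/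

import Mathlib

open Set Manifold Bundle
open scoped ContDiff Manifold Bundle

namespace HomSpace

noncomputable section

/-- The matrix of an element of a subgroup of `GL(n, 𝕜)`, as the array of its entries. -/
def entries {𝕜 : Type*} [RCLike 𝕜] {n : ℕ} {G : Subgroup (GL (Fin n) 𝕜)} (g : G) :
    Fin n → Fin n → 𝕜 :=
  fun i j => (g : GL (Fin n) 𝕜).val i j

/-- A matrix Lie group: a closed subgroup `G` of `GL(n, 𝕜)`, `𝕜 = ℝ` or `ℂ`, with its structure
of a (real, finite-dimensional) Lie group for the subspace topology, for which the inclusion into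
the space of matrices is an immersion. -/
structure IsMatrixLieGroup {𝕜 : Type*} [RCLike 𝕜] {n : ℕ} (G : Subgroup (GL (Fin n) 𝕜))
    (E : Type*) [NormedAddCommGroup E] [NormedSpace ℝ E] [FiniteDimensional ℝ E]
    [ChartedSpace E G] [LieGroup 𝓘(ℝ, E) ∞ G] : Prop where
  isClosed : IsClosed (G : Set (GL (Fin n) 𝕜))
  isImmersion : IsImmersion 𝓘(ℝ, E) 𝓘(ℝ, Fin n → Fin n → 𝕜) ∞ (entries (G := G))

/-- The matrix of an element of the Lie algebra `T_e G` of a matrix Lie group, that is, its image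
under the derivative of the inclusion of `G` in the space of matrices. -/
def lieMatrix {𝕜 : Type*} [RCLike 𝕜] {n : ℕ} {G : Subgroup (GL (Fin n) 𝕜)}
    {E : Type*} [NormedAddCommGroup E] [NormedSpace ℝ E] [ChartedSpace E G]
    (A : GroupLieAlgebra 𝓘(ℝ, E) G) : Matrix (Fin n) (Fin n) 𝕜 :=
  Matrix.of (mfderiv 𝓘(ℝ, E) 𝓘(ℝ, Fin n → Fin n → 𝕜) (entries (G := G)) 1 A)

/-- The Riemannian metric on the Lie group `G` is bi-invariant: left and right translations
preserve it. -/
structure IsBiInvariant {E : Type*} [NormedAddCommGroup E] [NormedSpace ℝ E]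
    (G : Type*) [TopologicalSpace G] [Group G] [ChartedSpace E G]
    [RiemannianBundle (fun g : G => TangentSpace 𝓘(ℝ, E) g)] : Prop where
  left : ∀ (g h : G) (v w : TangentSpace 𝓘(ℝ, E) h),
    inner ℝ (mfderiv 𝓘(ℝ, E) 𝓘(ℝ, E) (fun x : G => g * x) h v)
      (mfderiv 𝓘(ℝ, E) 𝓘(ℝ, E) (fun x : G => g * x) h w) = inner ℝ v w
  right : ∀ (g h : G) (v w : TangentSpace 𝓘(ℝ, E) h),
    inner ℝ (mfderiv 𝓘(ℝ, E) 𝓘(ℝ, E) (fun x : G => x * g) h v)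
      (mfderiv 𝓘(ℝ, E) 𝓘(ℝ, E) (fun x : G => x * g) h w) = inner ℝ v w

/-- A tangent vector `v` at `x` is horizontal for the map `f` if it is orthogonal to the kernel of
the derivative of `f` at `x`. -/
def IsHorizontal {E F : Type*} [NormedAddCommGroup E] [NormedSpace ℝ E]
    [NormedAddCommGroup F] [NormedSpace ℝ F]
    {X Y : Type*} [TopologicalSpace X] [ChartedSpace E X] [TopologicalSpace Y] [ChartedSpace F Y]
    [RiemannianBundle (fun x : X => TangentSpace 𝓘(ℝ, E) x)]
    (f : X → Y) (x : X) (v : TangentSpace 𝓘(ℝ, E) x) : Prop :=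
  ∀ u : TangentSpace 𝓘(ℝ, E) x, mfderiv 𝓘(ℝ, E) 𝓘(ℝ, F) f x u = 0 → inner ℝ v u = 0

/-- The homogeneous space `G / H`: the subgroup `H` is closed and `G / H` carries its smooth
structure, the one for which the projection `G → G / H` is a smooth submersion. -/
structure IsHomogeneousSpace {E F : Type*} [NormedAddCommGroup E] [NormedSpace ℝ E]
    [NormedAddCommGroup F] [NormedSpace ℝ F] [FiniteDimensional ℝ F]
    {G : Type*} [TopologicalSpace G] [Group G] [ChartedSpace E G]
    (H : Subgroup G) [ChartedSpace F (G ⧸ H)] [IsManifold 𝓘(ℝ, F) ∞ (G ⧸ H)] : Prop where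
  isClosed : IsClosed (H : Set G)
  isSubmersion : IsSubmersion 𝓘(ℝ, E) 𝓘(ℝ, F) ∞ (fun g : G => (g : G ⧸ H))

/-- The Riemannian metric on `G / H` is induced by the one on `G`: at every point, the derivative
of the projection `G → G / H` restricts to an isometry on horizontal vectors. -/
def IsInducedMetric {E F : Type*} [NormedAddCommGroup E] [NormedSpace ℝ E]
    [NormedAddCommGroup F] [NormedSpace ℝ F]
    {G : Type*} [TopologicalSpace G] [Group G] [ChartedSpace E G]
    [RiemannianBundle (fun g : G => TangentSpace 𝓘(ℝ, E) g)]
    (H : Subgroup G) [ChartedSpace F (G ⧸ H)]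
    [RiemannianBundle (fun p : G ⧸ H => TangentSpace 𝓘(ℝ, F) p)] : Prop :=
  ∀ (g : G) (v w : TangentSpace 𝓘(ℝ, E) g),
    IsHorizontal (F := F) (fun x : G => (x : G ⧸ H)) g v →
    IsHorizontal (F := F) (fun x : G => (x : G ⧸ H)) g w →
    inner ℝ (mfderiv 𝓘(ℝ, E) 𝓘(ℝ, F) (fun x : G => (x : G ⧸ H)) g v)
      (mfderiv 𝓘(ℝ, E) 𝓘(ℝ, F) (fun x : G => (x : G ⧸ H)) g w) = inner ℝ v w

/-- `γ : [0, 1] → M` is a length-minimizing geodesic from `p` to `q` with initial velocity `X`: a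
`C^1` curve of constant speed whose length is the Riemannian distance from `p` to `q`. -/
structure IsMinGeodesic {F : Type*} [NormedAddCommGroup F] [NormedSpace ℝ F]
    {M : Type*} [TopologicalSpace M] [ChartedSpace F M]
    [RiemannianBundle (fun p : M => TangentSpace 𝓘(ℝ, F) p)]
    (γ : ℝ → M) (p q : M) (X : TangentSpace 𝓘(ℝ, F) p) : Prop where
  contMDiffOn : ContMDiffOn 𝓘(ℝ, ℝ) 𝓘(ℝ, F) 1 γ (Icc 0 1)
  /-- `γ 0 = p` and the velocity of `γ` at time `0` is `X` -/
  initial : (⟨γ 0, mfderivWithin 𝓘(ℝ, ℝ) 𝓘(ℝ, F) γ (Icc 0 1) 0 (1 : ℝ)⟩ :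
    TangentBundle 𝓘(ℝ, F) M) = ⟨p, X⟩
  final : γ 1 = q
  speed : ∀ t ∈ Icc (0 : ℝ) 1,
    ‖mfderivWithin 𝓘(ℝ, ℝ) 𝓘(ℝ, F) γ (Icc 0 1) t (1 : ℝ)‖ = ‖X‖
  length : pathELength 𝓘(ℝ, F) γ 0 1 = riemannianEDist 𝓘(ℝ, F) p q

/-- `X` is a Riemannian logarithm of `q` at `p`, and `q` is the Riemannian exponential of `X`
at `p`: some length-minimizing geodesic `[0, 1] → M` from `p` to `q` has initial velocity `X`.
Where `log_p q` is defined, i.e. where the minimizing geodesic from `p` to `q` is unique,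
`X = log_p q` is the only such vector. -/
def IsRiemLog {F : Type*} [NormedAddCommGroup F] [NormedSpace ℝ F]
    {M : Type*} [TopologicalSpace M] [ChartedSpace F M]
    [RiemannianBundle (fun p : M => TangentSpace 𝓘(ℝ, F) p)]
    (p q : M) (X : TangentSpace 𝓘(ℝ, F) p) : Prop :=
  ∃ γ : ℝ → M, IsMinGeodesic γ p q X

end

end HomSpace

/-! Left invariance of the metric makes left translations preserve horizontality, so `G` acts on `G
⧸ H` by isometries (`IsHomogeneousSpace.inner_smul`). An isometry preserves lengths of curves, which
gives (i), and equality by using the inverse.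

For (ii), the point is that a minimizing geodesic `γ` from `p` is the orbit `exp(tA) p` of its
horizontal initial direction `A`. This is Noether's theorem. Varying `γ` to `θ (s f(t)) • γ t`, with
`θ` a one-parameter subgroup generated by `B` and `f` vanishing at both ends, and applying the du
Bois-Reymond lemma shows that the product of the velocity of `γ` with the fundamental field of `B`
is constant in time. Right invariance turns this product into the inner product of `B` with the
horizontal representative of the velocity (`IsHomogeneousSpace.inner_fundamentalVector`). Since `B`
is arbitrary, that representative is constantly `A`. No geodesic equation or connection is needed.

Hence `θ (-t) • γ t` is constant for the subgroup `θ` of `A`, so `exp(-A) q = p`. Translating by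
`exp(-A)`, the distance from `p` to `exp(-A) p` is that from `q` to `p`. The orbit of `p` under
`exp(-tA)` has exactly this length, so it is minimizing, and its initial velocity is `-X`. -/

namespace HomSpace

open Filter Topology

/-! ### Local sections of submersions -/

section LocalSection

variable {E F : Type*} [NormedAddCommGroup E] [NormedSpace ℝ E]
  [NormedAddCommGroup F] [NormedSpace ℝ F]
  {X Y : Type*} [TopologicalSpace X] [ChartedSpace E X] [TopologicalSpace Y] [ChartedSpace F Y]

/-- A submersion has a smooth local section through every point of its domain. -/
theorem exists_local_section {f : X → Y} {x : X} (hf : IsSubmersionAt 𝓘(ℝ, E) 𝓘(ℝ, F) ∞ f x) :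
    ∃ σ : Y → X, σ (f x) = x ∧ ContMDiffAt 𝓘(ℝ, F) 𝓘(ℝ, E) ∞ σ (f x) ∧
      ∀ᶠ y in 𝓝 (f x), f (σ y) = y := by
  set φ := hf.domChart
  set ψ := hf.codChart
  set e := hf.equiv
  have hx : x ∈ φ.source := hf.mem_domChart_source
  have hy : f x ∈ ψ.source := hf.mem_codChart_source
  have hw : ∀ z ∈ φ.target, ψ (f (φ.symm z)) = (e z).1 := by
    intro z hz
    have := hf.writtenInCharts (show z ∈ (φ.extend 𝓘(ℝ, E)).target by simpa using hz)
    simpa using this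
  have hex : (e (φ x)).1 = ψ (f x) := by
    rw [← hw _ (φ.map_source hx), φ.left_inv hx]
  -- In adapted charts `f` is the first projection; freezing the second coordinate at its value at
  -- `x` gives a section through `x`.
  let j : F → E := fun u => e.symm (u, (e (φ x)).2)
  have hj : ContDiff ℝ ∞ j := e.symm.contDiff.comp (contDiff_id.prodMk contDiff_const)
  have hjx : j (ψ (f x)) = φ x := by
    simp only [j, ← hex, Prod.mk.eta, ContinuousLinearEquiv.symm_apply_apply]
  have hψs : ContMDiffAt 𝓘(ℝ, F) 𝓘(ℝ, F) ∞ ψ (f x) :=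
    contMDiffAt_of_mem_maximalAtlas hf.codChart_mem_maximalAtlas hy
  have hjψ : ContMDiffAt 𝓘(ℝ, F) 𝓘(ℝ, E) ∞ (fun y => j (ψ y)) (f x) :=
    hj.contMDiff.contMDiffAt.comp (f x) hψs
  have hσ : ContMDiffAt 𝓘(ℝ, F) 𝓘(ℝ, E) ∞ (fun y => φ.symm (j (ψ y))) (f x) := by
    refine ContMDiffAt.comp (I' := 𝓘(ℝ, E)) (f x) (g := φ.symm) ?_ hjψ
    exact contMDiffAt_symm_of_mem_maximalAtlas hf.domChart_mem_maximalAtlas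
      (by rw [hjx]; exact φ.map_source hx)
  refine ⟨fun y => φ.symm (j (ψ y)), by simp only [hjx, φ.left_inv hx], hσ, ?_⟩
  have h1 : ∀ᶠ y in 𝓝 (f x), j (ψ y) ∈ φ.target :=
    hjψ.continuousAt (φ.open_target.mem_nhds (by simpa only [hjx] using φ.map_source hx))
  filter_upwards [h1, ψ.open_source.mem_nhds hy] with y h1 h2
  have h3 : f (φ.symm (j (ψ y))) ∈ ψ.source := hf.source_subset_preimage_source (φ.map_target h1)
  apply ψ.injOn h3 h2
  rw [hw _ h1]
  simp [j]

end LocalSection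

/-! ### Smoothness of the action and separation of the quotient -/

section Action

variable {E F : Type*} [NormedAddCommGroup E] [NormedSpace ℝ E]
  [NormedAddCommGroup F] [NormedSpace ℝ F] [FiniteDimensional ℝ F]
  {G : Type*} [TopologicalSpace G] [Group G] [ChartedSpace E G]
  {H : Subgroup G} [ChartedSpace F (G ⧸ H)] [IsManifold 𝓘(ℝ, F) ∞ (G ⧸ H)]

theorem IsHomogeneousSpace.contMDiff_mk (hM : IsHomogeneousSpace (E := E) (F := F) H) :
    ContMDiff 𝓘(ℝ, E) 𝓘(ℝ, F) ∞ (fun g : G => (g : G ⧸ H)) := by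
  obtain ⟨K, _, _, h⟩ := hM.isSubmersion
  exact h.contMDiff

/-- The action of `G` on `G / H` is smooth. -/
theorem IsHomogeneousSpace.contMDiffSMul [LieGroup 𝓘(ℝ, E) ∞ G] (hM : IsHomogeneousSpace (E := E) (F := F) H) :
    ContMDiffSMul 𝓘(ℝ, E) 𝓘(ℝ, F) ∞ G (G ⧸ H) := by
  refine ⟨fun ⟨g, x⟩ => ?_⟩
  obtain ⟨a, rfl⟩ := QuotientGroup.mk_surjective x
  obtain ⟨σ, hσa, hσ, hs⟩ := exists_local_section (hM.isSubmersion.isSubmersionAt a)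
  -- Near `a` the action lifts through the section to multiplication in `G` followed by the
  -- projection.
  have h1 : ContMDiffAt (𝓘(ℝ, E).prod 𝓘(ℝ, F)) 𝓘(ℝ, F) ∞
      (fun p : G × (G ⧸ H) => ((p.1 * σ p.2 : G) : G ⧸ H)) (g, (a : G ⧸ H)) := by
    refine (hM.contMDiff_mk.contMDiffAt).comp (g, (a : G ⧸ H)) ?_
    refine ContMDiffAt.mul contMDiffAt_fst ?_
    exact ContMDiffAt.comp (I' := 𝓘(ℝ, F)) (g, (a : G ⧸ H)) (g := σ) hσ contMDiffAt_snd
  refine h1.congr_of_eventuallyEq ?_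
  have h2 : Tendsto (fun p : G × (G ⧸ H) => p.2) (𝓝 (g, (a : G ⧸ H))) (𝓝 (a : G ⧸ H)) :=
    continuousAt_snd
  filter_upwards [h2.eventually hs] with p hp
  conv_lhs => rw [← hp]
  rfl

/-- The quotient map is open, and its equivalence relation is closed because `H` is. Separation is
what allows uniqueness of integral curves in `G ⧸ H`. -/
theorem IsHomogeneousSpace.t2Space [IsTopologicalGroup G]
    (hM : IsHomogeneousSpace (E := E) (F := F) H) : T2Space (G ⧸ H) := by
  have hq : IsOpenQuotientMap (QuotientGroup.mk : G → G ⧸ H) :=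
    QuotientGroup.isOpenQuotientMap_mk
  rw [t2Space_iff_of_isOpenQuotientMap hq]
  have : {q : G × G | (q.1 : G ⧸ H) = q.2} = (fun q : G × G => q.1⁻¹ * q.2) ⁻¹' H := by
    ext q; simp [QuotientGroup.eq]
  rw [this]
  exact hM.isClosed.preimage (by fun_prop)

end Action

/-! ### Horizontal parts, translations and orbit maps -/

section Horizontal

variable {E F : Type*} [NormedAddCommGroup E] [NormedSpace ℝ E] [FiniteDimensional ℝ E]
  [NormedAddCommGroup F] [NormedSpace ℝ F]
  {X Y : Type*} [TopologicalSpace X] [ChartedSpace E X] [TopologicalSpace Y] [ChartedSpace F Y]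
  [RiemannianBundle (fun x : X => TangentSpace 𝓘(ℝ, E) x)]

instance (x : X) : FiniteDimensional ℝ (TangentSpace 𝓘(ℝ, E) x) :=
  inferInstanceAs (FiniteDimensional ℝ E)

/-- Every tangent vector has a horizontal part with the same image. -/
theorem exists_isHorizontal (f : X → Y) (x : X) (v : TangentSpace 𝓘(ℝ, E) x) :
    ∃ h : TangentSpace 𝓘(ℝ, E) x, IsHorizontal (F := F) f x h ∧
      mfderiv 𝓘(ℝ, E) 𝓘(ℝ, F) f x h = mfderiv 𝓘(ℝ, E) 𝓘(ℝ, F) f x v := by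
  let K : Submodule ℝ (TangentSpace 𝓘(ℝ, E) x) :=
    LinearMap.ker (mfderiv 𝓘(ℝ, E) 𝓘(ℝ, F) f x).toLinearMap
  refine ⟨v - K.starProjection v, fun u hu => ?_, ?_⟩
  · have h := K.sub_starProjection_mem_orthogonal v
    rw [Submodule.mem_orthogonal'] at h
    exact h u hu
  · have h : mfderiv 𝓘(ℝ, E) 𝓘(ℝ, F) f x (K.starProjection v) = 0 :=
      K.starProjection_apply_mem v
    rw [map_sub, h, sub_zero]

end Horizontal

section Translations

variable {E F : Type*} [NormedAddCommGroup E] [NormedSpace ℝ E]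
  [NormedAddCommGroup F] [NormedSpace ℝ F]
  {G : Type*} [TopologicalSpace G] [Group G] [ChartedSpace E G] [LieGroup 𝓘(ℝ, E) ∞ G]

theorem mdifferentiableAt_mul_left (a g : G) :
    MDifferentiableAt 𝓘(ℝ, E) 𝓘(ℝ, E) (fun x : G => a * x) g :=
  (contMDiff_mul_left (I := 𝓘(ℝ, E)) (n := ∞) (a := a)).mdifferentiableAt (by simp)

theorem mdifferentiableAt_mul_right (a g : G) :
    MDifferentiableAt 𝓘(ℝ, E) 𝓘(ℝ, E) (fun x : G => x * a) g :=
  (contMDiff_mul_right (I := 𝓘(ℝ, E)) (n := ∞) (a := a)).mdifferentiableAt (by simp)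

/-- A map with a differentiable left inverse has an injective derivative. -/
theorem mfderiv_injective_of_leftInverse
    {X Y : Type*} [TopologicalSpace X] [ChartedSpace E X] [TopologicalSpace Y] [ChartedSpace F Y]
    {f : X → Y} {g : Y → X} {x : X} (hg : MDifferentiableAt 𝓘(ℝ, F) 𝓘(ℝ, E) g (f x))
    (hf : MDifferentiableAt 𝓘(ℝ, E) 𝓘(ℝ, F) f x) (h : ∀ y, g (f y) = y)
    {v : TangentSpace 𝓘(ℝ, E) x} (hv : mfderiv 𝓘(ℝ, E) 𝓘(ℝ, F) f x v = 0) : v = 0 := by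
  have h1 : HasMFDerivAt 𝓘(ℝ, E) 𝓘(ℝ, E) (g ∘ f) x
      ((mfderiv 𝓘(ℝ, F) 𝓘(ℝ, E) g (f x)).comp (mfderiv 𝓘(ℝ, E) 𝓘(ℝ, F) f x)) :=
    hg.hasMFDerivAt.comp x hf.hasMFDerivAt
  have h2 : g ∘ f = id := funext h
  rw [h2] at h1
  have h3 := hasMFDerivAt_unique h1 (hasMFDerivAt_id x)
  have h4 : mfderiv 𝓘(ℝ, F) 𝓘(ℝ, E) g (f x) (mfderiv 𝓘(ℝ, E) 𝓘(ℝ, F) f x v) = v :=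
    DFunLike.congr_fun h3 v
  rw [← h4, hv, map_zero]
  rfl

theorem mfderiv_mul_left_surjective [FiniteDimensional ℝ E] (a g : G)
    (u : TangentSpace 𝓘(ℝ, E) (a * g)) :
    ∃ v : TangentSpace 𝓘(ℝ, E) g, mfderiv 𝓘(ℝ, E) 𝓘(ℝ, E) (fun x : G => a * x) g v = u := by
  let T : E →ₗ[ℝ] E := (mfderiv 𝓘(ℝ, E) 𝓘(ℝ, E) (fun x : G => a * x) g).toLinearMap
  have : Function.Injective T := (injective_iff_map_eq_zero T).2 fun v hv =>
    mfderiv_injective_of_leftInverse (x := g) (mdifferentiableAt_mul_left a⁻¹ _)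
      (mdifferentiableAt_mul_left a g) (fun y => by simp) hv
  exact LinearMap.injective_iff_surjective.1 this u

theorem mfderiv_mul_right_surjective [FiniteDimensional ℝ E] (a g : G)
    (u : TangentSpace 𝓘(ℝ, E) (g * a)) :
    ∃ v : TangentSpace 𝓘(ℝ, E) g, mfderiv 𝓘(ℝ, E) 𝓘(ℝ, E) (fun x : G => x * a) g v = u := by
  let T : E →ₗ[ℝ] E := (mfderiv 𝓘(ℝ, E) 𝓘(ℝ, E) (fun x : G => x * a) g).toLinearMap
  have : Function.Injective T := (injective_iff_map_eq_zero T).2 fun v hv =>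
    mfderiv_injective_of_leftInverse (x := g) (mdifferentiableAt_mul_right a⁻¹ _)
      (mdifferentiableAt_mul_right a g) (fun y => by simp) hv
  exact LinearMap.injective_iff_surjective.1 this u

end Translations

section Action

variable {F : Type*} [NormedAddCommGroup F] [NormedSpace ℝ F]
  {G : Type*} [TopologicalSpace G] [Group G]
  {M : Type*} [TopologicalSpace M] [ChartedSpace F M] [MulAction G M]

theorem contMDiff_const_smul (E : Type*) [NormedAddCommGroup E] [NormedSpace ℝ E]
    [ChartedSpace E G] [ContMDiffSMul 𝓘(ℝ, E) 𝓘(ℝ, F) ∞ G M] (g : G) :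
    ContMDiff 𝓘(ℝ, F) 𝓘(ℝ, F) ∞ (fun x : M => g • x) :=
  (contMDiff_smul (I := 𝓘(ℝ, E)) (I' := 𝓘(ℝ, F)) (n := ∞) (G := G)).comp
    (contMDiff_const.prodMk contMDiff_id)

theorem mdifferentiableAt_const_smul (E : Type*) [NormedAddCommGroup E] [NormedSpace ℝ E]
    [ChartedSpace E G] [ContMDiffSMul 𝓘(ℝ, E) 𝓘(ℝ, F) ∞ G M] (g : G) (x : M) :
    MDifferentiableAt 𝓘(ℝ, F) 𝓘(ℝ, F) (fun x : M => g • x) x :=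
  (contMDiff_const_smul E g).mdifferentiableAt (by simp)

theorem mfderiv_const_smul_eq_zero (E : Type*) [NormedAddCommGroup E] [NormedSpace ℝ E]
    [ChartedSpace E G] [ContMDiffSMul 𝓘(ℝ, E) 𝓘(ℝ, F) ∞ G M] {g : G} {x : M} {v : TangentSpace 𝓘(ℝ, F) x}
    (hv : mfderiv 𝓘(ℝ, F) 𝓘(ℝ, F) (fun x : M => g • x) x v = 0) : v = 0 :=
  mfderiv_injective_of_leftInverse (mdifferentiableAt_const_smul E g⁻¹ (g • x))
    (mdifferentiableAt_const_smul E g x) (fun y => by simp) hv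

end Action

section SMul

variable {E F : Type*} [NormedAddCommGroup E] [NormedSpace ℝ E]
  [NormedAddCommGroup F] [NormedSpace ℝ F]
  {G : Type*} [TopologicalSpace G] [Group G] [ChartedSpace E G]
  {M : Type*} [TopologicalSpace M] [ChartedSpace F M] [MulAction G M]

/-- The value at `x` of the vector field on `M` generated by `B` under the action of `G`. -/
noncomputable def fundamentalVector (B : GroupLieAlgebra 𝓘(ℝ, E) G) (x : M) :
    TangentSpace 𝓘(ℝ, F) x :=
  (mfderiv 𝓘(ℝ, E) 𝓘(ℝ, F) (fun g : G => g • x) 1 B : F)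

variable [ContMDiffSMul 𝓘(ℝ, E) 𝓘(ℝ, F) ∞ G M]

theorem mdifferentiable_smul :
    MDifferentiable (𝓘(ℝ, E).prod 𝓘(ℝ, F)) 𝓘(ℝ, F) (fun p : G × M => p.1 • p.2) :=
  (contMDiff_smul (I := 𝓘(ℝ, E)) (I' := 𝓘(ℝ, F)) (n := ∞)).mdifferentiable (by simp)

variable (E F)

theorem contMDiff_smul_const (x : M) :
    ContMDiff 𝓘(ℝ, E) 𝓘(ℝ, F) ∞ (fun g : G => g • x) :=
  (contMDiff_smul (I := 𝓘(ℝ, E)) (I' := 𝓘(ℝ, F)) (n := ∞)).comp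
    (contMDiff_id.prodMk contMDiff_const)

theorem mdifferentiableAt_smul_const (g : G) (x : M) :
    MDifferentiableAt 𝓘(ℝ, E) 𝓘(ℝ, F) (fun g : G => g • x) g :=
  (contMDiff_smul_const E F x).mdifferentiableAt (by simp)

end SMul

/-! ### The action is isometric, and the metric in terms of the Lie algebra -/

section Isometry

variable {E F : Type*} [NormedAddCommGroup E] [NormedSpace ℝ E] [FiniteDimensional ℝ E]
  [NormedAddCommGroup F] [NormedSpace ℝ F] [FiniteDimensional ℝ F]
  {G : Type*} [TopologicalSpace G] [Group G] [ChartedSpace E G] [LieGroup 𝓘(ℝ, E) ∞ G]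
  [RiemannianBundle (fun g : G => TangentSpace 𝓘(ℝ, E) g)]
  {H : Subgroup G} [ChartedSpace F (G ⧸ H)] [IsManifold 𝓘(ℝ, F) ∞ (G ⧸ H)]
  [RiemannianBundle (fun p : G ⧸ H => TangentSpace 𝓘(ℝ, F) p)]

omit [FiniteDimensional ℝ E] [LieGroup 𝓘(ℝ, E) ∞ G]
  [RiemannianBundle (fun g : G => TangentSpace 𝓘(ℝ, E) g)]
  [RiemannianBundle (fun p : G ⧸ H => TangentSpace 𝓘(ℝ, F) p)] in
theorem IsHomogeneousSpace.mfderiv_mk_surjective (hM : IsHomogeneousSpace (E := E) (F := F) H)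
    (g : G) (X : TangentSpace 𝓘(ℝ, F) (g : G ⧸ H)) :
    ∃ u, mfderiv 𝓘(ℝ, E) 𝓘(ℝ, F) (fun x : G => (x : G ⧸ H)) g u = X := by
  obtain ⟨σ, hσg, hσ, hs⟩ := exists_local_section (hM.isSubmersion.isSubmersionAt g)
  have h1 : HasMFDerivAt 𝓘(ℝ, F) 𝓘(ℝ, E) σ (g : G ⧸ H) _ :=
    (hσ.mdifferentiableAt (by simp)).hasMFDerivAt
  have h2 : HasMFDerivAt 𝓘(ℝ, E) 𝓘(ℝ, F) (fun x : G => (x : G ⧸ H)) (σ (g : G ⧸ H)) _ :=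
    (hM.contMDiff_mk.mdifferentiableAt (by simp)).hasMFDerivAt
  have h3 := h2.comp _ h1
  have h4 : HasMFDerivAt 𝓘(ℝ, F) 𝓘(ℝ, F) ((fun x : G => (x : G ⧸ H)) ∘ σ) (g : G ⧸ H)
      (ContinuousLinearMap.id ℝ _) := (hasMFDerivAt_id _).congr_of_eventuallyEq hs
  have h5 := DFunLike.congr_fun (hasMFDerivAt_unique h3 h4) X
  have h6 : σ (g : G ⧸ H) = g := hσg
  rw [ContinuousLinearMap.comp_apply] at h5
  -- The vector lives over `σ (g : G ⧸ H)`, which equals `g` only propositionally; it is generalized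
  -- so that the base point can be rewritten.
  generalize mfderiv 𝓘(ℝ, F) 𝓘(ℝ, E) σ (g : G ⧸ H) X = u at h5
  revert u
  rw [h6]
  exact fun u h5 => ⟨u, h5⟩

omit [FiniteDimensional ℝ E] [RiemannianBundle (fun g : G => TangentSpace 𝓘(ℝ, E) g)]
  [RiemannianBundle (fun p : G ⧸ H => TangentSpace 𝓘(ℝ, F) p)] in
theorem IsHomogeneousSpace.mfderiv_smul_mfderiv_mk (hM : IsHomogeneousSpace (E := E) (F := F) H)
    (a g : G) (u : TangentSpace 𝓘(ℝ, E) g) :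
    mfderiv 𝓘(ℝ, F) 𝓘(ℝ, F) (fun x : G ⧸ H => a • x) (g : G ⧸ H)
        (mfderiv 𝓘(ℝ, E) 𝓘(ℝ, F) (fun x : G => (x : G ⧸ H)) g u) =
      mfderiv 𝓘(ℝ, E) 𝓘(ℝ, F) (fun x : G => (x : G ⧸ H)) (a * g)
        (mfderiv 𝓘(ℝ, E) 𝓘(ℝ, E) (fun x : G => a * x) g u) := by
  have := hM.contMDiffSMul
  have h1 := (mdifferentiableAt_const_smul E a (g : G ⧸ H)).hasMFDerivAt.comp g
    (f := fun x : G => (x : G ⧸ H)) (hM.contMDiff_mk.mdifferentiableAt (by simp)).hasMFDerivAt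
  have h2 := HasMFDerivAt.comp g (g := fun x : G => (x : G ⧸ H))
    (hM.contMDiff_mk.mdifferentiableAt (by simp)).hasMFDerivAt
    (mdifferentiableAt_mul_left (E := E) a g).hasMFDerivAt
  exact DFunLike.congr_fun (hasMFDerivAt_unique h1 h2) u

omit [RiemannianBundle (fun p : G ⧸ H => TangentSpace 𝓘(ℝ, F) p)] in
/-- Left translations of `G` preserve horizontality with respect to the projection. -/
theorem IsHomogeneousSpace.isHorizontal_mul_left (hM : IsHomogeneousSpace (E := E) (F := F) H)
    (hbi : IsBiInvariant (E := E) G) (a g : G) {v : TangentSpace 𝓘(ℝ, E) g}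
    (hv : IsHorizontal (F := F) (fun x : G => (x : G ⧸ H)) g v) :
    IsHorizontal (F := F) (fun x : G => (x : G ⧸ H)) (a * g)
      (mfderiv 𝓘(ℝ, E) 𝓘(ℝ, E) (fun x : G => a * x) g v) := by
  have := hM.contMDiffSMul
  intro u hu
  obtain ⟨u, rfl⟩ := mfderiv_mul_left_surjective a g u
  rw [hbi.left]
  apply hv
  rw [← hM.mfderiv_smul_mfderiv_mk] at hu
  exact mfderiv_const_smul_eq_zero E hu

/-- `G` acts on `G / H` by isometries. -/
theorem IsHomogeneousSpace.inner_smul (hM : IsHomogeneousSpace (E := E) (F := F) H)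
    (hbi : IsBiInvariant (E := E) G) (hind : IsInducedMetric (E := E) (F := F) H)
    (a : G) (x : G ⧸ H) (v w : TangentSpace 𝓘(ℝ, F) x) :
    inner ℝ (mfderiv 𝓘(ℝ, F) 𝓘(ℝ, F) (fun x : G ⧸ H => a • x) x v)
      (mfderiv 𝓘(ℝ, F) 𝓘(ℝ, F) (fun x : G ⧸ H => a • x) x w) = inner ℝ v w := by
  obtain ⟨g, rfl⟩ := QuotientGroup.mk_surjective x
  obtain ⟨v, rfl⟩ := hM.mfderiv_mk_surjective g v
  obtain ⟨w, rfl⟩ := hM.mfderiv_mk_surjective g w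
  obtain ⟨v, hv, h⟩ := exists_isHorizontal (F := F) (fun x : G => (x : G ⧸ H)) g v
  rw [← h]
  obtain ⟨w, hw, h'⟩ := exists_isHorizontal (F := F) (fun x : G => (x : G ⧸ H)) g w
  rw [← h', hind g v w hv hw, ← hbi.left a g v w,
    ← hind (a * g) _ _ (hM.isHorizontal_mul_left hbi a g hv) (hM.isHorizontal_mul_left hbi a g hw),
    ← hM.mfderiv_smul_mfderiv_mk, ← hM.mfderiv_smul_mfderiv_mk]
  rfl

theorem IsHomogeneousSpace.norm_smul (hM : IsHomogeneousSpace (E := E) (F := F) H)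
    (hbi : IsBiInvariant (E := E) G) (hind : IsInducedMetric (E := E) (F := F) H)
    (a : G) (x : G ⧸ H) (v : TangentSpace 𝓘(ℝ, F) x) :
    ‖mfderiv 𝓘(ℝ, F) 𝓘(ℝ, F) (fun x : G ⧸ H => a • x) x v‖ = ‖v‖ := by
  rw [@norm_eq_sqrt_real_inner _ _ _ v, norm_eq_sqrt_real_inner, hM.inner_smul hbi hind]

omit [FiniteDimensional ℝ E] [RiemannianBundle (fun g : G => TangentSpace 𝓘(ℝ, E) g)]
  [RiemannianBundle (fun p : G ⧸ H => TangentSpace 𝓘(ℝ, F) p)] in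
theorem IsHomogeneousSpace.mfderiv_orbit (hM : IsHomogeneousSpace (E := E) (F := F) H)
    (a : G) (u : TangentSpace 𝓘(ℝ, E) (1 : G)) :
    mfderiv 𝓘(ℝ, E) 𝓘(ℝ, F) (fun g : G => g • (a : G ⧸ H)) 1 u =
      mfderiv 𝓘(ℝ, E) 𝓘(ℝ, F) (fun x : G => (x : G ⧸ H)) (1 * a)
        (mfderiv 𝓘(ℝ, E) 𝓘(ℝ, E) (fun x : G => x * a) 1 u) := by
  have h2 := HasMFDerivAt.comp 1 (g := fun x : G => (x : G ⧸ H))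
    (hM.contMDiff_mk.mdifferentiableAt (by simp)).hasMFDerivAt
    (mdifferentiableAt_mul_right (E := E) a (1 : G)).hasMFDerivAt
  exact DFunLike.congr_fun h2.mfderiv u

-- The orbit map of the coset of `a` is the projection after right translation by `a`. That
-- translation therefore matches the two kernels, and right invariance preserves orthogonality to
-- them.
omit [RiemannianBundle (fun p : G ⧸ H => TangentSpace 𝓘(ℝ, F) p)] in
theorem IsHomogeneousSpace.isHorizontal_mul_right (hM : IsHomogeneousSpace (E := E) (F := F) H)
    (hbi : IsBiInvariant (E := E) G) (a : G) {v : TangentSpace 𝓘(ℝ, E) (1 : G)}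
    (hv : IsHorizontal (F := F) (fun g : G => g • (a : G ⧸ H)) 1 v) :
    IsHorizontal (F := F) (fun x : G => (x : G ⧸ H)) (1 * a)
      (mfderiv 𝓘(ℝ, E) 𝓘(ℝ, E) (fun x : G => x * a) 1 v) := by
  intro u hu
  obtain ⟨u, rfl⟩ := mfderiv_mul_right_surjective a 1 u
  rw [hbi.right]
  apply hv
  rw [hM.mfderiv_orbit]
  exact hu

/-- The metric of `G / H` in terms of fundamental vectors. -/
theorem IsHomogeneousSpace.inner_fundamentalVector (hM : IsHomogeneousSpace (E := E) (F := F) H)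
    (hbi : IsBiInvariant (E := E) G) (hind : IsInducedMetric (E := E) (F := F) H)
    (x : G ⧸ H) {A : GroupLieAlgebra 𝓘(ℝ, E) G}
    (hA : IsHorizontal (F := F) (fun g : G => g • x) 1 A) (B : GroupLieAlgebra 𝓘(ℝ, E) G) :
    inner ℝ (fundamentalVector A x : TangentSpace 𝓘(ℝ, F) x) (fundamentalVector B x) =
      @inner ℝ (TangentSpace 𝓘(ℝ, E) (1 : G)) _ A B := by
  obtain ⟨a, rfl⟩ := QuotientGroup.mk_surjective x
  obtain ⟨C, hC, h⟩ := exists_isHorizontal (F := F) (fun g : G => g • (a : G ⧸ H)) 1 B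
  -- `B - C` is vertical, hence orthogonal to the horizontal `A`.
  have h1 : @inner ℝ (TangentSpace 𝓘(ℝ, E) (1 : G)) _ A B =
      @inner ℝ (TangentSpace 𝓘(ℝ, E) (1 : G)) _ A C := by
    have := hA (B - C) (by rw [map_sub, h, sub_self])
    rwa [inner_sub_right, sub_eq_zero] at this
  have key := hind (1 * a) _ _ (hM.isHorizontal_mul_right hbi a hA)
    (hM.isHorizontal_mul_right hbi a hC)
  rw [← hM.mfderiv_orbit, ← hM.mfderiv_orbit, h, hbi.right, ← h1] at key
  have h2 : ∀ y : G ⧸ H, y = a → ∀ v w : F, @inner ℝ (TangentSpace 𝓘(ℝ, F) y) _ v w =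
      @inner ℝ (TangentSpace 𝓘(ℝ, F) (a : G ⧸ H)) _ v w := by
    rintro y rfl v w; rfl
  rw [← key]
  exact (h2 _ (by rw [one_mul]) _ _).symm

omit [RiemannianBundle (fun p : G ⧸ H => TangentSpace 𝓘(ℝ, F) p)] in
/-- Every tangent vector of `G / H` is represented by a horizontal element of the Lie algebra. -/
theorem IsHomogeneousSpace.exists_fundamentalVector_eq
    (hM : IsHomogeneousSpace (E := E) (F := F) H) (x : G ⧸ H) (X : TangentSpace 𝓘(ℝ, F) x) :
    ∃ A : GroupLieAlgebra 𝓘(ℝ, E) G,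
      IsHorizontal (F := F) (fun g : G => g • x) 1 A ∧ fundamentalVector A x = X := by
  obtain ⟨a, rfl⟩ := QuotientGroup.mk_surjective x
  obtain ⟨u, hu⟩ := hM.mfderiv_mk_surjective (1 * a) X
  obtain ⟨v, rfl⟩ := mfderiv_mul_right_surjective a 1 u
  obtain ⟨A, hA, h⟩ := exists_isHorizontal (F := F) (fun g : G => g • (a : G ⧸ H)) 1 v
  refine ⟨A, hA, ?_⟩
  rw [← hM.mfderiv_orbit, ← h] at hu
  exact hu

end Isometry

/-! ### Regularity and rigidity of curves in manifolds -/

section Curves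

variable {E : Type*} [NormedAddCommGroup E] [NormedSpace ℝ E]
  {X : Type*} [TopologicalSpace X] [ChartedSpace E X]

/-- Integral curves of continuous vector fields are `C^1`. -/
theorem contMDiff_one_of_isMIntegralCurve [IsManifold 𝓘(ℝ, E) 1 X]
    {v : ∀ x : X, TangentSpace 𝓘(ℝ, E) x}
    (hv : Continuous (fun x => (⟨x, v x⟩ : TangentBundle 𝓘(ℝ, E) X))) {γ : ℝ → X}
    (hγ : IsMIntegralCurve (I := 𝓘(ℝ, E)) γ v) : ContMDiff 𝓘(ℝ, ℝ) 𝓘(ℝ, E) 1 γ := by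
  intro t₀
  rw [contMDiffAt_iff_target]
  refine ⟨hγ.continuous.continuousAt, ?_⟩
  rw [contMDiffAt_iff_contDiffAt, contDiffAt_one_iff]
  set e := trivializationAt E (TangentSpace 𝓘(ℝ, E) : X → Type _) (γ t₀) with he
  let w : ℝ → E := fun t => (e ⟨γ t, v (γ t)⟩).2
  let s : Set ℝ := γ ⁻¹' e.baseSet
  have hs : IsOpen s := e.open_baseSet.preimage hγ.continuous
  have hw : ContinuousOn w s := by
    refine continuous_snd.comp_continuousOn (e.continuousOn.comp
      (hv.comp hγ.continuous).continuousOn fun t ht => ?_)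
    exact e.mem_source.2 ht
  have hγ' := (hγ.isMIntegralCurveAt t₀).eventually_hasDerivAt
  refine ⟨fun t => (ContinuousLinearMap.toSpanSingleton ℝ (w t)),
    s ∩ {t | HasDerivAt ((extChartAt 𝓘(ℝ, E) (γ t₀)) ∘ γ) (w t) t}, ?_, ?_, ?_⟩
  · refine Filter.inter_mem (hs.mem_nhds ?_) hγ'
    exact FiberBundle.mem_baseSet_trivializationAt' (F := E)
      (E := (TangentSpace 𝓘(ℝ, E) : X → Type _)) (γ t₀)
  · refine ContinuousOn.mono ?_ inter_subset_left
    exact (ContinuousLinearMap.toSpanSingletonCLE (𝕜 := ℝ) (E := E)).continuous.comp_continuousOn hw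
  · exact fun t ht => ht.2.hasFDerivAt

/-- A curve with vanishing derivative on `[0, 1]` has the same end points. -/
theorem eq_of_hasMFDerivWithinAt_zero [T2Space X] [IsManifold 𝓘(ℝ, E) 1 X] {δ : ℝ → X}
    (h : ∀ t ∈ Icc (0 : ℝ) 1, HasMFDerivWithinAt 𝓘(ℝ, ℝ) 𝓘(ℝ, E) δ (Icc 0 1) t 0) :
    δ 1 = δ 0 := by
  have hc : ContinuousOn δ (Icc 0 1) := fun t ht => (h t ht).continuousWithinAt
  -- Both the curve and a constant curve are integral curves of the zero field, so they agree on the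
  -- open interval by uniqueness, and at the end points by continuity.
  let v : ∀ x : X, TangentSpace 𝓘(ℝ, E) x := fun _ => 0
  have hv : ContMDiff 𝓘(ℝ, E) 𝓘(ℝ, E).tangent 1
      (fun x => (⟨x, v x⟩ : TangentBundle 𝓘(ℝ, E) X)) := contMDiff_zeroSection _ _
  have h1 : IsMIntegralCurveOn (I := 𝓘(ℝ, E)) δ v (Ioo 0 1) := by
    intro t ht
    refine ((h t (Ioo_subset_Icc_self ht)).mono Ioo_subset_Icc_self).congr_mfderiv ?_
    exact (ContinuousLinearMap.smulRight_zero (1 : ℝ →L[ℝ] ℝ)).symm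
  have h2 : IsMIntegralCurveOn (I := 𝓘(ℝ, E)) (fun _ => δ (1 / 2)) v (Ioo 0 1) :=
    (isMIntegralCurve_const (I := 𝓘(ℝ, E)) (v := v) rfl).isMIntegralCurveOn _
  have h3 : EqOn δ (fun _ => δ (1 / 2)) (Ioo 0 1) :=
    isMIntegralCurveOn_Ioo_eqOn_of_contMDiff_boundaryless (t₀ := 1 / 2) (by norm_num) hv h1 h2 rfl
  have h4 : EqOn δ (fun _ => δ (1 / 2)) (Icc 0 1) :=
    h3.of_subset_closure hc continuousOn_const Ioo_subset_Icc_self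
      (by rw [closure_Ioo zero_ne_one])
  exact (h4 (right_mem_Icc.2 zero_le_one)).trans (h4 (left_mem_Icc.2 zero_le_one)).symm

/-- The squared speed of a `C^1` curve is continuous. -/
theorem continuousOn_norm_mfderivWithin_sq [IsManifold 𝓘(ℝ, E) ∞ X]
    [RiemannianBundle (fun x : X => TangentSpace 𝓘(ℝ, E) x)]
    [IsContMDiffRiemannianBundle 𝓘(ℝ, E) ∞ E (fun x : X => TangentSpace 𝓘(ℝ, E) x)]
    {γ : ℝ → X} (hγ : ContMDiffOn 𝓘(ℝ, ℝ) 𝓘(ℝ, E) 1 γ (Icc 0 1)) :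
    ContinuousOn (fun t => ‖mfderivWithin 𝓘(ℝ, ℝ) 𝓘(ℝ, E) γ (Icc 0 1) t (1 : ℝ)‖ ^ 2)
      (Icc 0 1) := by
  have : IsManifold 𝓘(ℝ, E) 1 X := .of_le (n := ∞) (by simp)
  have h1 := hγ.continuousOn_tangentMapWithin le_rfl
    (uniqueDiffOn_Icc (zero_lt_one (α := ℝ))).uniqueMDiffOn
  have h2 : Continuous (fun t : ℝ => (⟨t, (1 : ℝ)⟩ : TangentBundle 𝓘(ℝ, ℝ) ℝ)) := 
    (contMDiff_vectorSpace_iff_contDiff (V := fun _ : ℝ => (1 : ℝ)) (n := 1)).2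
      contDiff_const |>.continuous
  have h3 : ContinuousOn (fun t : ℝ => (⟨γ t, mfderivWithin 𝓘(ℝ, ℝ) 𝓘(ℝ, E) γ (Icc 0 1) t (1 : ℝ)⟩ :
      TangentBundle 𝓘(ℝ, E) X)) (Icc 0 1) := h1.comp h2.continuousOn fun t ht => ht
  have : IsContinuousRiemannianBundle E (fun x : X => TangentSpace 𝓘(ℝ, E) x) := by
    obtain ⟨g, hg, hg'⟩ := IsContMDiffRiemannianBundle.exists_contMDiff (IB := 𝓘(ℝ, E)) (n := ∞)
      (F := E) (E := fun x : X => TangentSpace 𝓘(ℝ, E) x)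
    exact ⟨g, hg.continuous, hg'⟩
  simp_rw [← real_inner_self_eq_norm_sq]
  exact ContinuousOn.inner_bundle (F := E) (E := fun x : X => TangentSpace 𝓘(ℝ, E) x) h3 h3

end Curves

/-! ### One-parameter subgroups and the curves they move -/

section OneParameter

variable {E : Type*} [NormedAddCommGroup E] [NormedSpace ℝ E] [CompleteSpace E]
  {G : Type*} [TopologicalSpace G] [Group G] [ChartedSpace E G] [LieGroup 𝓘(ℝ, E) ∞ G]

omit [CompleteSpace E] in
theorem mfderiv_mul_left_mulInvariantVectorField (B : GroupLieAlgebra 𝓘(ℝ, E) G) (a g : G) :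
    mfderiv 𝓘(ℝ, E) 𝓘(ℝ, E) (fun x : G => a * x) g (mulInvariantVectorField B g) =
      mulInvariantVectorField B (a * g) := by
  have h1 := HasMFDerivAt.comp 1 (g := fun x : G => a * x) (f := fun x : G => g * x)
    (mdifferentiableAt_mul_left (E := E) a (g * 1)).hasMFDerivAt
    (mdifferentiableAt_mul_left (E := E) g 1).hasMFDerivAt
  have h2 : (fun x : G => a * x) ∘ (fun x : G => g * x) = fun x => (a * g) * x :=
    funext fun x => (mul_assoc a g x).symm
  rw [h2] at h1
  have h3 := DFunLike.congr_fun h1.mfderiv B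
  rw [mulInvariantVectorField, mulInvariantVectorField, h3]
  have h4 : ∀ y : G, y = g → ∀ u : E, (mfderiv 𝓘(ℝ, E) 𝓘(ℝ, E) (fun x : G => a * x) g u : E) =
      mfderiv 𝓘(ℝ, E) 𝓘(ℝ, E) (fun x : G => a * x) y u := by
    rintro y rfl u; rfl
  exact h4 (g * 1) (mul_one g) _

/-- Left translates of one local integral curve through `1` are integral curves through every point,
all on the same time interval; this uniform lifetime makes the field complete. -/
theorem exists_integralCurve_mulInvariantVectorField [T2Space G]
    (B : GroupLieAlgebra 𝓘(ℝ, E) G) :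
    ∃ θ : ℝ → G, θ 0 = 1 ∧ ContMDiff 𝓘(ℝ, ℝ) 𝓘(ℝ, E) 1 θ ∧
      IsMIntegralCurve (I := 𝓘(ℝ, E)) θ (mulInvariantVectorField B) := by
  have i3 : LieGroup 𝓘(ℝ, E) (minSmoothness ℝ 3) G := .of_le (n := ∞) (by
    simpa using ENat.LEInfty.out)
  have i1 : IsManifold 𝓘(ℝ, E) 1 G := .of_le (n := ∞) (by simp)
  have hv : ContMDiff 𝓘(ℝ, E) 𝓘(ℝ, E).tangent 1
      (fun g => (⟨g, mulInvariantVectorField B g⟩ : TangentBundle 𝓘(ℝ, E) G)) :=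
    (contMDiff_mulInvariantVectorField B).of_le (by simp)
  obtain ⟨γ, hγ1, hγ⟩ := exists_isMIntegralCurveAt_of_contMDiffAt_boundaryless
    (t₀ := 0) (hv.contMDiffAt (x := 1))
  rw [isMIntegralCurveAt_iff'] at hγ
  obtain ⟨ε, hε, hγ⟩ := hγ
  rw [Real.ball_eq_Ioo, zero_sub, zero_add] at hγ
  obtain ⟨θ, hθ, hθ'⟩ := exists_isMIntegralCurve_of_isMIntegralCurveOn hv hε (fun g => by
    refine ⟨fun t => g * γ t, by simp [hγ1], fun t ht => ?_⟩
    have h1 := (mdifferentiableAt_mul_left (E := E) g (γ t)).hasMFDerivAt.comp_hasMFDerivWithinAt t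
      (hγ t ht)
    refine h1.congr_mfderiv ?_
    rw [← mfderiv_mul_left_mulInvariantVectorField]
    exact ContinuousLinearMap.ext fun r =>
      (mfderiv 𝓘(ℝ, E) 𝓘(ℝ, E) (fun x : G => g * x) (γ t)).map_smul (r : ℝ) _) 1
  exact ⟨θ, hθ, contMDiff_one_of_isMIntegralCurve hv.continuous hθ', hθ'⟩

end OneParameter

section Product

variable {E F : Type*} [NormedAddCommGroup E] [NormedSpace ℝ E]
  [NormedAddCommGroup F] [NormedSpace ℝ F]
  {G : Type*} [TopologicalSpace G] [Group G] [ChartedSpace E G] [LieGroup 𝓘(ℝ, E) ∞ G]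
  {M : Type*} [TopologicalSpace M] [ChartedSpace F M] [MulAction G M]
  [ContMDiffSMul 𝓘(ℝ, E) 𝓘(ℝ, F) ∞ G M]

/-- Differentiate `(g * a) • x = g • (a • x)` in `a` at `1`. -/
theorem mfderiv_smul_const_mulInvariantVectorField (B : GroupLieAlgebra 𝓘(ℝ, E) G) (g : G) (x : M) :
    mfderiv 𝓘(ℝ, E) 𝓘(ℝ, F) (fun a : G => a • x) g (mulInvariantVectorField B g) =
      mfderiv 𝓘(ℝ, F) 𝓘(ℝ, F) (fun y : M => g • y) x (fundamentalVector B x) := by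
  have h1 := HasMFDerivAt.comp 1 (g := fun y : M => g • y) (f := fun a : G => a • x)
    (mdifferentiableAt_const_smul E g ((1 : G) • x)).hasMFDerivAt
    (mdifferentiableAt_smul_const E F (1 : G) x).hasMFDerivAt
  have h2 := HasMFDerivAt.comp 1 (g := fun a : G => a • x) (f := fun a : G => g * a)
    (mdifferentiableAt_smul_const E F (g * 1) x).hasMFDerivAt
    (mdifferentiableAt_mul_left (E := E) g 1).hasMFDerivAt
  have h0 : (fun a : G => a • x) ∘ (fun a : G => g * a) =
      (fun y : M => g • y) ∘ (fun a : G => a • x) := funext fun a => mul_smul g a x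
  rw [h0] at h2
  have h3 := DFunLike.congr_fun (hasMFDerivAt_unique h2 h1) B
  have h4 : ∀ y : G, y = g → ∀ u : E, (mfderiv 𝓘(ℝ, E) 𝓘(ℝ, F) (fun a : G => a • x) g u : F) =
      mfderiv 𝓘(ℝ, E) 𝓘(ℝ, F) (fun a : G => a • x) y u := by
    rintro y rfl u; rfl
  have h5 : ∀ y : M, y = x → ∀ u : F, (mfderiv 𝓘(ℝ, F) 𝓘(ℝ, F) (fun y : M => g • y) x u : F) =
      mfderiv 𝓘(ℝ, F) 𝓘(ℝ, F) (fun y : M => g • y) y u := by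
    rintro y rfl u; rfl
  exact (h4 (g * 1) (mul_one g) _).trans (h3.trans (h5 ((1 : G) • x) (one_smul G x) _).symm)

theorem smulRight_comp_toSpanSingleton (u : E) (r : ℝ) :
    ((1 : ℝ →L[ℝ] ℝ).smulRight u).comp (ContinuousLinearMap.toSpanSingleton ℝ r) =
      ContinuousLinearMap.toSpanSingleton ℝ (r • u) := by
  ext; simp

theorem comp_prod_toSpanSingleton (D : E × F →L[ℝ] F) (u : E) (v : F) :
    D.comp ((ContinuousLinearMap.toSpanSingleton ℝ u).prod
      (ContinuousLinearMap.toSpanSingleton ℝ v)) =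
      ContinuousLinearMap.toSpanSingleton ℝ (D (u, v)) := by
  ext; simp

/-- The velocity of `t ↦ θ (f t) • γ t` for an integral curve `θ` of a left-invariant field. -/
theorem hasMFDerivWithinAt_smul {B : GroupLieAlgebra 𝓘(ℝ, E) G} {θ : ℝ → G}
    (hθ : IsMIntegralCurve (I := 𝓘(ℝ, E)) θ (mulInvariantVectorField B)) {f : ℝ → ℝ} {f' t : ℝ}
    {s : Set ℝ} (hf : HasDerivWithinAt f f' s t) {γ : ℝ → M} {X : TangentSpace 𝓘(ℝ, F) (γ t)}
    (hγ : HasMFDerivWithinAt 𝓘(ℝ, ℝ) 𝓘(ℝ, F) γ s t (ContinuousLinearMap.toSpanSingleton ℝ X)) :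
    HasMFDerivWithinAt 𝓘(ℝ, ℝ) 𝓘(ℝ, F) (fun t => θ (f t) • γ t) s t
      (ContinuousLinearMap.toSpanSingleton ℝ
        (mfderiv 𝓘(ℝ, F) 𝓘(ℝ, F) (fun y : M => θ (f t) • y) (γ t)
          (X + f' • (fundamentalVector B (γ t))))) := by
  let u : TangentSpace 𝓘(ℝ, E) (θ (f t)) := f' • mulInvariantVectorField B (θ (f t))
  have h1 : HasMFDerivWithinAt 𝓘(ℝ, ℝ) 𝓘(ℝ, E) (θ ∘ f) s t
      (ContinuousLinearMap.toSpanSingleton ℝ u) := by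
    refine ((hθ (f t)).comp_hasMFDerivWithinAt t
      hf.hasFDerivWithinAt.hasMFDerivWithinAt).congr_mfderiv ?_
    exact smulRight_comp_toSpanSingleton (E := E) (mulInvariantVectorField B (θ (f t))) f'
  have h2 := (mdifferentiable_smul (E := E) (F := F) (θ (f t), γ t)).hasMFDerivAt
    |>.comp_hasMFDerivWithinAt t (h1.prodMk hγ)
  refine h2.congr_mfderiv ?_
  have h3 : (mfderiv (𝓘(ℝ, E).prod 𝓘(ℝ, F)) 𝓘(ℝ, F) (fun p : G × M => p.1 • p.2)
      (θ (f t), γ t) (u, X) : F) =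
      mfderiv 𝓘(ℝ, F) 𝓘(ℝ, F) (fun y : M => θ (f t) • y) (γ t)
          (X + f' • (fundamentalVector B (γ t))) := by
    have h4 := mfderiv_prod_eq_add_apply (I := 𝓘(ℝ, E)) (I' := 𝓘(ℝ, F)) (I'' := 𝓘(ℝ, F))
      (mdifferentiable_smul (E := E) (F := F) (θ (f t), γ t))
      (v := (show TangentSpace (𝓘(ℝ, E).prod 𝓘(ℝ, F)) (θ (f t), γ t) from ((u, X) : E × F)))
    have h5 : mfderiv 𝓘(ℝ, F) 𝓘(ℝ, F) (fun y : M => θ (f t) • y) (γ t)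
        (X + f' • (fundamentalVector B (γ t))) =
        mfderiv 𝓘(ℝ, F) 𝓘(ℝ, F) (fun y : M => θ (f t) • y) (γ t) X +
          mfderiv 𝓘(ℝ, E) 𝓘(ℝ, F) (fun a : G => a • γ t) (θ (f t)) u := by
      rw [map_add, map_smul, map_smul, mfderiv_smul_const_mulInvariantVectorField]
    exact h4.trans ((add_comm _ _).trans h5.symm)
  rw [← h3]
  exact comp_prod_toSpanSingleton (E := E) (F := F) _ u X

end Product

/-! ### The du Bois-Reymond lemma -/

section DuBoisReymond

/-- The du Bois-Reymond lemma for continuous functions on `[0, 1]`. -/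
theorem eq_of_forall_integral_deriv_mul_eq_zero {m : ℝ → ℝ} (hm : ContinuousOn m (Icc 0 1))
    (h : ∀ f : ℝ → ℝ, ContDiff ℝ 1 f → f 0 = 0 → f 1 = 0 →
      ∫ t in (0 : ℝ)..1, deriv f t * m t = 0) {t : ℝ} (ht : t ∈ Icc (0 : ℝ) 1) : m t = m 0 := by
  -- Constant extension beyond the end points makes the function continuous on the whole line, so
  -- that its primitive is a global `C^1` test function.
  set n : ℝ → ℝ := IccExtend zero_le_one ((Icc (0 : ℝ) 1).domRestrict m) with hn
  have hnc : Continuous n := (continuousOn_iff_continuous_domRestrict.1 hm).Icc_extend'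
  have hnm : EqOn n m (Icc 0 1) := fun t ht => by
    simp only [hn, IccExtend_of_mem _ _ ht, domRestrict_apply]
  set μ : ℝ := ∫ t in (0 : ℝ)..1, n t with hμ
  have hg : Continuous fun t => n t - μ := hnc.sub continuous_const
  have hd : ∀ t, HasDerivAt (fun t => ∫ s in (0 : ℝ)..t, (n s - μ)) (n t - μ) t := fun t =>
    intervalIntegral.integral_hasDerivAt_right (hg.intervalIntegrable _ _)
      (hg.stronglyMeasurableAtFilter _ _) hg.continuousAt
  have hderiv : deriv (fun t => ∫ s in (0 : ℝ)..t, (n s - μ)) = fun t => n t - μ :=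
    funext fun t => (hd t).deriv
  have h0 : ∫ s in (0 : ℝ)..1, (n s - μ) = 0 := by
    rw [intervalIntegral.integral_sub (hnc.intervalIntegrable _ _)
      intervalIntegrable_const]
    simp [hμ]
  -- This test function vanishes at `1` because `μ` is the mean of `n`; testing with it yields a
  -- vanishing integral of `(n - μ)²`.
  have h1 := h (fun t => ∫ s in (0 : ℝ)..t, (n s - μ))
    (contDiff_one_iff_deriv.2 ⟨fun t => (hd t).differentiableAt, by rwa [hderiv]⟩)
    (by simp) h0
  rw [hderiv] at h1
  have h2 : ∫ t in (0 : ℝ)..1, (n t - μ) * (n t - μ) = 0 := by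
    have h3 : ∫ t in (0 : ℝ)..1, (n t - μ) * m t = ∫ t in (0 : ℝ)..1, (n t - μ) * n t := by
      refine intervalIntegral.integral_congr fun t ht => ?_
      rw [uIcc_of_le zero_le_one] at ht
      simp only [hnm ht]
    simp_rw [mul_sub (_ - _)]
    rw [intervalIntegral.integral_sub (f := fun t => (n t - μ) * n t)
      (g := fun t => (n t - μ) * μ) ((hg.mul hnc).intervalIntegrable _ _) ((hg.mul continuous_const).intervalIntegrable _ _), ← h3, h1,
      intervalIntegral.integral_mul_const, h0]
    simp
  have h4 : ∀ t ∈ Icc (0 : ℝ) 1, n t = μ := by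
    by_contra! hne
    obtain ⟨t, ht, hne⟩ := hne
    have := intervalIntegral.integral_pos (zero_lt_one (α := ℝ)) (hg.mul hg).continuousOn
      (fun x _ => mul_self_nonneg _) ⟨t, ht, mul_self_pos.2 (sub_ne_zero.2 hne)⟩
    exact this.ne' h2
  rw [← hnm ht, ← hnm (left_mem_Icc.2 zero_le_one), h4 t ht, h4 0 (left_mem_Icc.2 zero_le_one)]

end DuBoisReymond

/-! ### Invariance of the distance and the first variation along the action -/

section Variation

variable {E F : Type*} [NormedAddCommGroup E] [NormedSpace ℝ E] [FiniteDimensional ℝ E]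
  [NormedAddCommGroup F] [NormedSpace ℝ F] [FiniteDimensional ℝ F]
  {G : Type*} [TopologicalSpace G] [Group G] [ChartedSpace E G] [LieGroup 𝓘(ℝ, E) ∞ G]
  [RiemannianBundle (fun g : G => TangentSpace 𝓘(ℝ, E) g)]
  {H : Subgroup G} [ChartedSpace F (G ⧸ H)] [IsManifold 𝓘(ℝ, F) ∞ (G ⧸ H)]
  [RiemannianBundle (fun p : G ⧸ H => TangentSpace 𝓘(ℝ, F) p)]

theorem uniqueMDiffWithinAt_unitInterval {t : ℝ} (ht : t ∈ Icc (0 : ℝ) 1) :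
    UniqueMDiffWithinAt 𝓘(ℝ, ℝ) (Icc (0 : ℝ) 1) t :=
  (uniqueDiffOn_Icc (zero_lt_one (α := ℝ)) t ht).uniqueMDiffWithinAt

theorem riemannianEDist_smul_le (hM : IsHomogeneousSpace (E := E) (F := F) H)
    (hbi : IsBiInvariant (E := E) G) (hind : IsInducedMetric (E := E) (F := F) H)
    (a : G) (p q : G ⧸ H) :
    riemannianEDist 𝓘(ℝ, F) (a • p) (a • q) ≤ riemannianEDist 𝓘(ℝ, F) p q := by
  have := hM.contMDiffSMul
  refine le_of_forall_gt fun r hr => ?_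
  obtain ⟨γ, hγ0, hγ1, hγ, hlt⟩ := exists_lt_of_riemannianEDist_lt hr
  have h1 : ContMDiffOn 𝓘(ℝ, ℝ) 𝓘(ℝ, F) 1 (fun t => a • γ t) (Icc 0 1) :=
    ((contMDiff_const_smul E a).of_le (by simp)).comp_contMDiffOn hγ
  refine (riemannianEDist_le_pathELength h1 (by simp only [hγ0]) (by simp only [hγ1])
    zero_le_one).trans_lt (lt_of_le_of_lt (le_of_eq ?_) hlt)
  rw [pathELength_eq_lintegral_mfderivWithin_Icc, pathELength_eq_lintegral_mfderivWithin_Icc]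
  refine MeasureTheory.setLIntegral_congr_fun measurableSet_Icc fun t ht => ?_
  rw [enorm_eq_iff_norm_eq, ← hM.norm_smul hbi hind a (γ t)]
  have h2 := (mdifferentiableAt_const_smul E a (γ t)).hasMFDerivAt.comp_hasMFDerivWithinAt t
    ((hγ.mdifferentiableOn one_ne_zero) t ht).hasMFDerivWithinAt
  have h3 := h2.mfderivWithin (uniqueMDiffWithinAt_unitInterval ht)
  exact congrArg norm (DFunLike.congr_fun h3 (1 : ℝ))

theorem riemannianEDist_smul (hM : IsHomogeneousSpace (E := E) (F := F) H)
    (hbi : IsBiInvariant (E := E) G) (hind : IsInducedMetric (E := E) (F := F) H)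
    (a : G) (p q : G ⧸ H) :
    riemannianEDist 𝓘(ℝ, F) (a • p) (a • q) = riemannianEDist 𝓘(ℝ, F) p q := by
  refine le_antisymm (riemannianEDist_smul_le hM hbi hind a p q) ?_
  simpa using riemannianEDist_smul_le hM hbi hind a⁻¹ (a • p) (a • q)

/-- The velocity of a curve on `[0, 1]`. -/
noncomputable def velocity (γ : ℝ → G ⧸ H) (t : ℝ) : TangentSpace 𝓘(ℝ, F) (γ t) :=
  mfderivWithin 𝓘(ℝ, ℝ) 𝓘(ℝ, F) γ (Icc 0 1) t (1 : ℝ)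

omit [IsManifold 𝓘(ℝ, F) ∞ (G ⧸ H)] [FiniteDimensional ℝ F] [LieGroup 𝓘(ℝ, E) ∞ G]
  [ChartedSpace E G] [RiemannianBundle (fun p : G ⧸ H => TangentSpace 𝓘(ℝ, F) p)]
  [RiemannianBundle (fun g : G => TangentSpace 𝓘(ℝ, E) g)] in
theorem hasMFDerivWithinAt_velocity {γ : ℝ → G ⧸ H}
    (hγ : ContMDiffOn 𝓘(ℝ, ℝ) 𝓘(ℝ, F) 1 γ (Icc 0 1)) {t : ℝ} (ht : t ∈ Icc (0 : ℝ) 1) :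
    HasMFDerivWithinAt 𝓘(ℝ, ℝ) 𝓘(ℝ, F) γ (Icc 0 1) t
      (ContinuousLinearMap.toSpanSingleton ℝ (velocity (F := F) γ t)) := by
  refine ((hγ.mdifferentiableOn one_ne_zero) t ht).hasMFDerivWithinAt.congr_mfderiv ?_
  exact ContinuousLinearMap.ext_ring (one_smul ℝ _).symm

omit [FiniteDimensional ℝ E] [RiemannianBundle (fun g : G => TangentSpace 𝓘(ℝ, E) g)]
  [RiemannianBundle (fun p : G ⧸ H => TangentSpace 𝓘(ℝ, F) p)] in
theorem velocity_smul (hM : IsHomogeneousSpace (E := E) (F := F) H)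
    {B : GroupLieAlgebra 𝓘(ℝ, E) G} {θ : ℝ → G}
    (hθ : IsMIntegralCurve (I := 𝓘(ℝ, E)) θ (mulInvariantVectorField B)) {f : ℝ → ℝ}
    (hf : ContDiff ℝ 1 f) {γ : ℝ → G ⧸ H}
    (hγ : ContMDiffOn 𝓘(ℝ, ℝ) 𝓘(ℝ, F) 1 γ (Icc 0 1)) {t : ℝ} (ht : t ∈ Icc (0 : ℝ) 1) :
    velocity (F := F) (fun t => θ (f t) • γ t) t =
      mfderiv 𝓘(ℝ, F) 𝓘(ℝ, F) (fun y : G ⧸ H => θ (f t) • y) (γ t)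
        (velocity γ t + deriv f t • fundamentalVector B (γ t)) := by
  have := hM.contMDiffSMul
  have h1 := hasMFDerivWithinAt_smul hθ
    ((hf.differentiable one_ne_zero t).hasDerivAt.hasDerivWithinAt (s := Icc 0 1))
    (hasMFDerivWithinAt_velocity hγ ht)
  have h2 := DFunLike.congr_fun (h1.mfderivWithin (uniqueMDiffWithinAt_unitInterval ht)) (1 : ℝ)
  exact h2.trans (one_smul ℝ _)

/-- Since `θ (f t)` acts isometrically, it drops out of the norm and leaves an exact quadratic
polynomial in the derivative of `f`. -/
theorem norm_velocity_smul_sq (hM : IsHomogeneousSpace (E := E) (F := F) H)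
    (hbi : IsBiInvariant (E := E) G) (hind : IsInducedMetric (E := E) (F := F) H)
    {B : GroupLieAlgebra 𝓘(ℝ, E) G} {θ : ℝ → G}
    (hθ : IsMIntegralCurve (I := 𝓘(ℝ, E)) θ (mulInvariantVectorField B)) {f : ℝ → ℝ}
    (hf : ContDiff ℝ 1 f) {γ : ℝ → G ⧸ H}
    (hγ : ContMDiffOn 𝓘(ℝ, ℝ) 𝓘(ℝ, F) 1 γ (Icc 0 1)) {t : ℝ} (ht : t ∈ Icc (0 : ℝ) 1) :
    ‖velocity (F := F) (fun t => θ (f t) • γ t) t‖ ^ 2 =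
      ‖velocity (F := F) γ t‖ ^ 2
        + 2 * (deriv f t * inner ℝ (velocity (F := F) γ t) (fundamentalVector B (γ t)))
        + deriv f t ^ 2 * ‖(fundamentalVector B (γ t) : TangentSpace 𝓘(ℝ, F) (γ t))‖ ^ 2 := by
  rw [velocity_smul hM hθ hf hγ ht, hM.norm_smul hbi hind, norm_add_sq_real, inner_smul_right,
    norm_smul, mul_pow, Real.norm_eq_abs, sq_abs]

omit [FiniteDimensional ℝ E] [RiemannianBundle (fun g : G => TangentSpace 𝓘(ℝ, E) g)]
  [RiemannianBundle (fun p : G ⧸ H => TangentSpace 𝓘(ℝ, F) p)] in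
theorem contMDiffOn_smul_curve (hM : IsHomogeneousSpace (E := E) (F := F) H)
    {θ : ℝ → G} (hθ : ContMDiff 𝓘(ℝ, ℝ) 𝓘(ℝ, E) 1 θ) {f : ℝ → ℝ}
    (hf : ContDiff ℝ 1 f) {γ : ℝ → G ⧸ H}
    (hγ : ContMDiffOn 𝓘(ℝ, ℝ) 𝓘(ℝ, F) 1 γ (Icc 0 1)) :
    ContMDiffOn 𝓘(ℝ, ℝ) 𝓘(ℝ, F) 1 (fun t => θ (f t) • γ t) (Icc 0 1) := by
  have := hM.contMDiffSMul
  exact ((contMDiff_smul (I := 𝓘(ℝ, E)) (I' := 𝓘(ℝ, F)) (n := ∞)).of_le (by simp)).comp_contMDiffOn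
    ((hθ.comp hf.contMDiff).contMDiffOn.prodMk hγ)

variable [IsContMDiffRiemannianBundle 𝓘(ℝ, F) ∞ F (fun p : G ⧸ H => TangentSpace 𝓘(ℝ, F) p)]

/-- By polarization: the squared speeds of `θ t • γ t` and `θ (-t) • γ t` are the squared norms of
the velocity plus and minus the fundamental vector, and squared speeds of `C^1` curves are
continuous. -/
theorem continuousOn_inner_fundamentalVector (hM : IsHomogeneousSpace (E := E) (F := F) H)
    (hbi : IsBiInvariant (E := E) G) (hind : IsInducedMetric (E := E) (F := F) H)
    {B : GroupLieAlgebra 𝓘(ℝ, E) G} {θ : ℝ → G} (hθ' : ContMDiff 𝓘(ℝ, ℝ) 𝓘(ℝ, E) 1 θ)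
    (hθ : IsMIntegralCurve (I := 𝓘(ℝ, E)) θ (mulInvariantVectorField B)) {γ : ℝ → G ⧸ H}
    (hγ : ContMDiffOn 𝓘(ℝ, ℝ) 𝓘(ℝ, F) 1 γ (Icc 0 1)) :
    ContinuousOn (fun t => inner ℝ (velocity (F := F) γ t) (fundamentalVector B (γ t)))
      (Icc 0 1) ∧
    ContinuousOn (fun t => ‖(fundamentalVector B (γ t) : TangentSpace 𝓘(ℝ, F) (γ t))‖ ^ 2)
      (Icc 0 1) := by
  have h0 : ContinuousOn (fun t => ‖velocity (F := F) γ t‖ ^ 2) (Icc 0 1) :=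
    continuousOn_norm_mfderivWithin_sq hγ
  have h1 : ContinuousOn (fun t => ‖velocity (F := F) (fun t => θ t • γ t) t‖ ^ 2) (Icc 0 1) :=
    continuousOn_norm_mfderivWithin_sq (contMDiffOn_smul_curve hM hθ' contDiff_id hγ)
  have h2 : ContinuousOn (fun t => ‖velocity (F := F) (fun t => θ (-t) • γ t) t‖ ^ 2) (Icc 0 1) :=
    continuousOn_norm_mfderivWithin_sq (contMDiffOn_smul_curve hM hθ' contDiff_neg hγ)
  constructor
  · refine ((h1.sub h2).div_const 4).congr fun t ht => ?_
    have e1 := norm_velocity_smul_sq hM hbi hind hθ contDiff_id hγ ht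
    have e2 := norm_velocity_smul_sq hM hbi hind hθ contDiff_neg hγ ht
    simp only [deriv_neg, deriv_id, id] at e1 e2
    simp only [Pi.sub_apply, e1, e2]
    ring
  · refine (((h1.add h2).sub (h0.const_smul (2 : ℝ))).div_const 2).congr fun t ht => ?_
    have e1 := norm_velocity_smul_sq hM hbi hind hθ contDiff_id hγ ht
    have e2 := norm_velocity_smul_sq hM hbi hind hθ contDiff_neg hγ ht
    simp only [deriv_neg, deriv_id, id] at e1 e2
    simp only [Pi.sub_apply, Pi.add_apply, e1, e2, smul_eq_mul, Pi.smul_apply]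
    ring

/-- First variation formula: a minimizing curve is stationary for variations along the action. -/
theorem IsMinGeodesic.integral_deriv_mul_inner_eq_zero
    (hM : IsHomogeneousSpace (E := E) (F := F) H)
    (hbi : IsBiInvariant (E := E) G) (hind : IsInducedMetric (E := E) (F := F) H)
    {B : GroupLieAlgebra 𝓘(ℝ, E) G} {θ : ℝ → G} (hθ0 : θ 0 = 1)
    (hθ' : ContMDiff 𝓘(ℝ, ℝ) 𝓘(ℝ, E) 1 θ)
    (hθ : IsMIntegralCurve (I := 𝓘(ℝ, E)) θ (mulInvariantVectorField B)) {γ : ℝ → G ⧸ H}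
    {p q : G ⧸ H} {X : TangentSpace 𝓘(ℝ, F) p} (hγ : IsMinGeodesic γ p q X)
    {f : ℝ → ℝ} (hf : ContDiff ℝ 1 f) (hf0 : f 0 = 0) (hf1 : f 1 = 0) :
    ∫ t in (0 : ℝ)..1, deriv f t *
      inner ℝ (velocity (F := F) γ t) (fundamentalVector B (γ t)) = 0 := by
  have hp : γ 0 = p := congrArg TotalSpace.proj hγ.initial
  have hspeed : ∀ t ∈ Icc (0 : ℝ) 1, ‖velocity (F := F) γ t‖ = ‖X‖ := hγ.speed
  obtain ⟨hm, hb⟩ := continuousOn_inner_fundamentalVector hM hbi hind hθ' hθ hγ.contMDiffOn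
  set m : ℝ → ℝ := fun t => inner ℝ (velocity (F := F) γ t) (fundamentalVector B (γ t)) with hmdef
  set b : ℝ → ℝ := fun t => ‖(fundamentalVector B (γ t) : TangentSpace 𝓘(ℝ, F) (γ t))‖ ^ 2
    with hbdef
  have hd : Continuous (deriv f) := hf.continuous_deriv le_rfl
  -- Zero speed is treated apart, since the estimate below divides by `c`.
  rcases (norm_nonneg X).eq_or_lt with hX | hX
  · have : ∀ t ∈ Icc (0 : ℝ) 1, deriv f t * m t = 0 := fun t ht => by
      have h1 : velocity (F := F) γ t = 0 := norm_eq_zero.1 ((hspeed t ht).trans hX.symm)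
      simp only [hmdef, h1, inner_zero_left, mul_zero]
    rw [intervalIntegral.integral_congr (g := fun _ => 0)]
    · simp
    · rwa [uIcc_of_le zero_le_one]
  set c := ‖X‖ with hc
  set P := ∫ t in (0 : ℝ)..1, deriv f t * m t with hP
  set Q := ∫ t in (0 : ℝ)..1, deriv f t ^ 2 * b t with hQ
  have hPi : IntervalIntegrable (fun t => deriv f t * m t) MeasureTheory.volume 0 1 :=
    (hd.continuousOn.mul hm).intervalIntegrable_of_Icc zero_le_one
  have hQi : IntervalIntegrable (fun t => deriv f t ^ 2 * b t) MeasureTheory.volume 0 1 :=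
    ((hd.pow 2).continuousOn.mul hb).intervalIntegrable_of_Icc zero_le_one
  have key : ∀ s : ℝ, 0 ≤ s * P + s ^ 2 * (Q / 2) := by
    intro s
    have hsf : ContDiff ℝ 1 (fun t => s * f t) := contDiff_const.mul hf
    have hsd : ∀ t, deriv (fun t => s * f t) t = s * deriv f t := fun t =>
      deriv_const_mul s (hf.differentiable one_ne_zero t)
    -- By the inequality `v ≤ (v² + c²) / (2c)`, an equality at `v = c`, the varied speed is bounded
    -- by a polynomial in `s`; no square root has to be differentiated.
    let h : ℝ → ℝ := fun t => c + (s / c) * (deriv f t * m t)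
      + (s ^ 2 / (2 * c)) * (deriv f t ^ 2 * b t)
    have hle : ∀ t ∈ Icc (0 : ℝ) 1,
        ‖velocity (F := F) (fun t => θ (s * f t) • γ t) t‖ ≤ h t := by
      intro t ht
      have e := norm_velocity_smul_sq hM hbi hind hθ hsf hγ.contMDiffOn ht
      rw [hsd, hspeed t ht] at e
      have e' : h t = (‖velocity (F := F) (fun t => θ (s * f t) • γ t) t‖ ^ 2 + c ^ 2) / (2 * c) := by
        rw [e]
        simp only [h, m, b]
        field_simp
        ring
      rw [e', le_div_iff₀ (by positivity)]
      nlinarith [sq_nonneg (‖velocity (F := F) (fun t => θ (s * f t) • γ t) t‖ - c)]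
    have hhi : IntervalIntegrable h MeasureTheory.volume 0 1 :=
      (intervalIntegrable_const.add (hPi.const_mul _)).add (hQi.const_mul _)
    have hint : ∫ t in (0 : ℝ)..1, h t = c + (s / c) * P + (s ^ 2 / (2 * c)) * Q := by
      simp only [h]
      rw [intervalIntegral.integral_add (intervalIntegrable_const.add (hPi.const_mul _))
        (hQi.const_mul _), intervalIntegral.integral_add intervalIntegrable_const
        (hPi.const_mul _), intervalIntegral.integral_const_mul, intervalIntegral.integral_const_mul]
      simp [hP, hQ]
    have h1 : riemannianEDist 𝓘(ℝ, F) p q = ENNReal.ofReal c := by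
      rw [← hγ.length, pathELength_eq_lintegral_mfderivWithin_Icc,
        MeasureTheory.setLIntegral_congr_fun (g := fun _ => ENNReal.ofReal c) measurableSet_Icc]
      · simp
      · intro t ht
        simp only
        rw [← ofReal_norm]
        exact congrArg ENNReal.ofReal (hspeed t ht)
    have h2 : riemannianEDist 𝓘(ℝ, F) p q ≤
        pathELength 𝓘(ℝ, F) (fun t => θ (s * f t) • γ t) 0 1 := by
      refine riemannianEDist_le_pathELength (contMDiffOn_smul_curve hM hθ' hsf hγ.contMDiffOn)
        ?_ ?_ zero_le_one
      · simp only [hf0, mul_zero, hθ0, one_smul, hp]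
      · simp only [hf1, mul_zero, hθ0, one_smul, hγ.final]
    have h3 : pathELength 𝓘(ℝ, F) (fun t => θ (s * f t) • γ t) 0 1 ≤
        ENNReal.ofReal (∫ t in (0 : ℝ)..1, h t) := by
      rw [pathELength_eq_lintegral_mfderivWithin_Icc, intervalIntegral.integral_of_le zero_le_one,
        ← MeasureTheory.integral_Icc_eq_integral_Ioc,
        MeasureTheory.ofReal_integral_eq_lintegral_ofReal
          ((intervalIntegrable_iff_integrableOn_Icc_of_le zero_le_one).1 hhi)]
      · refine MeasureTheory.setLIntegral_mono' measurableSet_Icc fun t ht => ?_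
        rw [← ofReal_norm]
        exact ENNReal.ofReal_le_ofReal (hle t ht)
      · filter_upwards [MeasureTheory.ae_restrict_mem measurableSet_Icc] with t ht
        exact (norm_nonneg _).trans (hle t ht)
    have h4 := (h1.symm.le.trans h2).trans h3
    rw [ENNReal.ofReal_le_ofReal_iff', hint] at h4
    have h5 : 0 ≤ (s / c) * P + (s ^ 2 / (2 * c)) * Q := by
      rcases h4 with h4 | h4 <;> linarith
    have h6 : (s / c) * P + (s ^ 2 / (2 * c)) * Q = (s * P + s ^ 2 * (Q / 2)) / c := by
      field_simp
    rw [h6, le_div_iff₀ hX, zero_mul] at h5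
    exact h5
  by_contra hne
  have hQ0 : 0 ≤ Q := intervalIntegral.integral_nonneg zero_le_one fun t _ => by positivity
  -- For nonzero `P` this value of `s` makes the polynomial negative; `Q + 1` replaces `Q` because
  -- `Q` may vanish.
  have := key (-P / (Q + 1))
  have h7 : -P / (Q + 1) * P + (-P / (Q + 1)) ^ 2 * (Q / 2) =
      -(P ^ 2 * (Q / 2 + 1)) / (Q + 1) ^ 2 := by
    field_simp
    ring
  rw [h7] at this
  have h8 : 0 < P ^ 2 * (Q / 2 + 1) / (Q + 1) ^ 2 := by positivity
  rw [neg_div] at this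
  linarith

end Variation

/-! ### One-parameter subgroups as matrix exponentials -/

section MatrixExp

open scoped Matrix.Norms.Operator in
/-- The solution of the matrix equation `c' = c A`, `c 0 = 1`, is the exponential. -/
theorem eq_exp_of_hasDerivAt {𝕜 : Type*} [RCLike 𝕜] {n : ℕ} {c : ℝ → Fin n → Fin n → 𝕜}
    {A : Matrix (Fin n) (Fin n) 𝕜} (h0 : Matrix.of (c 0) = 1)
    (hc : ∀ t, HasDerivAt c (Matrix.of.symm (Matrix.of (c t) * A)) t) (t : ℝ) :
    Matrix.of (c t) = NormedSpace.exp (t • A) := by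
  let L : (Fin n → Fin n → 𝕜) →ₗ[ℝ] Matrix (Fin n) (Fin n) 𝕜 :=
    (Matrix.ofLinearEquiv ℝ).toLinearMap
  have h1 : ∀ t, HasDerivAt (fun t => Matrix.of (c t)) (Matrix.of (c t) * A) t := fun t =>
    (LinearMap.toContinuousLinearMap L).hasFDerivAt.comp_hasDerivAt t (hc t)
  have h2 : ∀ t : ℝ, HasDerivAt (fun t : ℝ => NormedSpace.exp (t • (-A)))
      (-A * NormedSpace.exp (t • (-A))) t := fun t => hasDerivAt_exp_smul_const' (-A) t
  -- Multiplying by the inverse exponential gives a constant curve, which proves uniqueness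
  -- directly.
  have h3 : ∀ t, HasDerivAt (fun t => Matrix.of (c t) * NormedSpace.exp (t • (-A))) 0 t := by
    intro t
    convert! (h1 t).mul (h2 t) using 1
    rw [neg_mul, mul_neg, mul_assoc, add_neg_cancel]
  have h4 := is_const_of_deriv_eq_zero (fun t => (h3 t).differentiableAt) (fun t => (h3 t).deriv) t 0
  simp only [h0, zero_smul, NormedSpace.exp_zero, mul_one] at h4
  have h5 : NormedSpace.exp (t • (-A)) * NormedSpace.exp (t • A) = 1 := by
    rw [← Matrix.exp_add_of_commute, smul_neg, neg_add_cancel, NormedSpace.exp_zero]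
    rw [smul_neg]
    exact (Commute.refl _).neg_left
  calc Matrix.of (c t) = Matrix.of (c t) * (NormedSpace.exp (t • (-A)) * NormedSpace.exp (t • A)) := by
        rw [h5, mul_one]
    _ = NormedSpace.exp (t • A) := by rw [← mul_assoc, h4, one_mul]

variable {𝕜 : Type*} [RCLike 𝕜] {n : ℕ} {G : Subgroup (GL (Fin n) 𝕜)}
  {E : Type*} [NormedAddCommGroup E] [NormedSpace ℝ E] [FiniteDimensional ℝ E]
  [ChartedSpace E G] [LieGroup 𝓘(ℝ, E) ∞ G]

theorem IsMatrixLieGroup.mdifferentiable_entries (hG : IsMatrixLieGroup G E) :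
    MDifferentiable 𝓘(ℝ, E) 𝓘(ℝ, Fin n → Fin n → 𝕜) (entries (G := G)) := by
  obtain ⟨K, _, _, h⟩ := hG.isImmersion
  exact h.contMDiff.mdifferentiable (by simp)

theorem IsMatrixLieGroup.mfderiv_entries (hG : IsMatrixLieGroup G E)
    (A : GroupLieAlgebra 𝓘(ℝ, E) G) (g : G) :
    (mfderiv 𝓘(ℝ, E) 𝓘(ℝ, Fin n → Fin n → 𝕜) (entries (G := G)) g
      (mulInvariantVectorField A g) : Fin n → Fin n → 𝕜) =
      Matrix.of.symm (Matrix.of (entries g) * lieMatrix A) := by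
  -- On matrices, left translation by `g` is the restriction of this linear map, which is its own
  -- derivative.
  let L : (Fin n → Fin n → 𝕜) →L[ℝ] (Fin n → Fin n → 𝕜) :=
    LinearMap.toContinuousLinearMap
      { toFun := fun a => Matrix.of.symm (Matrix.of (entries g) * Matrix.of a)
        map_add' := fun a b =>
          congrArg Matrix.of.symm (Matrix.mul_add _ (Matrix.of a) (Matrix.of b))
        map_smul' := fun r a =>
          congrArg Matrix.of.symm (Matrix.mul_smul (Matrix.of (entries g)) r (Matrix.of a)) }
  have h1 := HasMFDerivAt.comp 1 (f := fun a : G => g * a) (hG.mdifferentiable_entries (g * 1)).hasMFDerivAt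
    (mdifferentiableAt_mul_left (E := E) g 1).hasMFDerivAt
  have h2 := HasMFDerivAt.comp 1 (f := entries (G := G)) (L.hasFDerivAt.hasMFDerivAt)
    (hG.mdifferentiable_entries 1).hasMFDerivAt
  have h0 : entries (G := G) ∘ (fun a : G => g * a) = L ∘ entries (G := G) := by
    rfl
  rw [h0] at h1
  have h3 := DFunLike.congr_fun (hasMFDerivAt_unique h1 h2) A
  have h4 : ∀ y : G, y = g → ∀ u : E,
      (mfderiv 𝓘(ℝ, E) 𝓘(ℝ, Fin n → Fin n → 𝕜) (entries (G := G)) g u : Fin n → Fin n → 𝕜) =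
      mfderiv 𝓘(ℝ, E) 𝓘(ℝ, Fin n → Fin n → 𝕜) (entries (G := G)) y u := by
    rintro y rfl u; rfl
  exact (h4 (g * 1) (mul_one g) _).trans h3

/-- One-parameter subgroups of a matrix Lie group are given by the matrix exponential. -/
theorem IsMatrixLieGroup.val_integralCurve (hG : IsMatrixLieGroup G E)
    {A : GroupLieAlgebra 𝓘(ℝ, E) G} {θ : ℝ → G} (hθ0 : θ 0 = 1)
    (hθ : IsMIntegralCurve (I := 𝓘(ℝ, E)) θ (mulInvariantVectorField A)) (t : ℝ) :
    (θ t : GL (Fin n) 𝕜).val = NormedSpace.exp (t • lieMatrix A) := by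
  refine eq_exp_of_hasDerivAt (c := fun t => entries (θ t)) ?_ (fun t => ?_) t
  · rw [hθ0]
    rfl
  · have h1 := (hG.mdifferentiable_entries (θ t)).hasMFDerivAt.comp t (hθ t)
    have h2 : HasFDerivAt (fun t => entries (θ t)) (ContinuousLinearMap.toSpanSingleton ℝ
        (Matrix.of.symm (Matrix.of (entries (θ t)) * lieMatrix A))) t := by
      refine hasMFDerivAt_iff_hasFDerivAt.1 (h1.congr_mfderiv ?_)
      rw [← hG.mfderiv_entries]
      exact ContinuousLinearMap.ext fun r =>
        (mfderiv 𝓘(ℝ, E) 𝓘(ℝ, Fin n → Fin n → 𝕜) (entries (G := G)) (θ t)).map_smul (r : ℝ) _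
    exact hasDerivAt_iff_hasFDerivAt.2 h2

end MatrixExp

/-! ### Minimizing geodesics as orbits of one-parameter subgroups -/

section Geodesic

variable {E F : Type*} [NormedAddCommGroup E] [NormedSpace ℝ E] [FiniteDimensional ℝ E]
  [NormedAddCommGroup F] [NormedSpace ℝ F] [FiniteDimensional ℝ F]
  {G : Type*} [TopologicalSpace G] [Group G] [ChartedSpace E G] [LieGroup 𝓘(ℝ, E) ∞ G]
  [RiemannianBundle (fun g : G => TangentSpace 𝓘(ℝ, E) g)]
  {H : Subgroup G} [ChartedSpace F (G ⧸ H)] [IsManifold 𝓘(ℝ, F) ∞ (G ⧸ H)]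
  [RiemannianBundle (fun p : G ⧸ H => TangentSpace 𝓘(ℝ, F) p)]
  [IsContMDiffRiemannianBundle 𝓘(ℝ, F) ∞ F (fun p : G ⧸ H => TangentSpace 𝓘(ℝ, F) p)]

/-- The velocity of a minimizing geodesic is given by a fixed element of the Lie algebra. -/
theorem IsMinGeodesic.velocity_eq_fundamentalVector [T2Space G]
    (hM : IsHomogeneousSpace (E := E) (F := F) H)
    (hbi : IsBiInvariant (E := E) G) (hind : IsInducedMetric (E := E) (F := F) H)
    {γ : ℝ → G ⧸ H} {p q : G ⧸ H} {X : TangentSpace 𝓘(ℝ, F) p} (hγ : IsMinGeodesic γ p q X)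
    {A : GroupLieAlgebra 𝓘(ℝ, E) G}
    (hA : IsHorizontal (F := F) (fun g : G => g • γ 0) 1 A)
    (hA0 : fundamentalVector A (γ 0) = velocity (F := F) γ 0) {t : ℝ} (ht : t ∈ Icc (0 : ℝ) 1) :
    velocity (F := F) γ t = fundamentalVector A (γ t) := by
  obtain ⟨C, hC, hCt⟩ := hM.exists_fundamentalVector_eq (γ t) (velocity (F := F) γ t)
  -- Conservation of momentum: the product of the velocity with the fundamental vector of `B` is the
  -- same at times `t` and `0`, and each side is an inner product in the Lie algebra.
  have key : ∀ B : GroupLieAlgebra 𝓘(ℝ, E) G, @inner ℝ (TangentSpace 𝓘(ℝ, E) (1 : G)) _ C B =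
      @inner ℝ (TangentSpace 𝓘(ℝ, E) (1 : G)) _ A B := by
    intro B
    obtain ⟨θ, hθ0, hθ', hθ⟩ := exists_integralCurve_mulInvariantVectorField B
    have h1 := eq_of_forall_integral_deriv_mul_eq_zero
      (continuousOn_inner_fundamentalVector hM hbi hind hθ' hθ hγ.contMDiffOn).1
      (fun f hf hf0 hf1 =>
        hγ.integral_deriv_mul_inner_eq_zero hM hbi hind hθ0 hθ' hθ hf hf0 hf1) ht
    simp only [← hCt, ← hA0] at h1
    rwa [hM.inner_fundamentalVector hbi hind _ hC, hM.inner_fundamentalVector hbi hind _ hA] at h1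
  have hCA : C = A := ext_inner_right ℝ (E := TangentSpace 𝓘(ℝ, E) (1 : G)) key
  rw [← hCt, hCA]

/-- Along `θ (-t) • γ t` the velocity of `γ` and the contribution of `θ (-t)` cancel, both being
given by `A`; the curve has zero velocity and is constant. -/
theorem IsMinGeodesic.smul_final_eq_initial [T2Space G] [IsTopologicalGroup G]
    (hM : IsHomogeneousSpace (E := E) (F := F) H)
    (hbi : IsBiInvariant (E := E) G) (hind : IsInducedMetric (E := E) (F := F) H)
    {γ : ℝ → G ⧸ H} {p q : G ⧸ H} {X : TangentSpace 𝓘(ℝ, F) p} (hγ : IsMinGeodesic γ p q X)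
    {A : GroupLieAlgebra 𝓘(ℝ, E) G}
    (hA : IsHorizontal (F := F) (fun g : G => g • γ 0) 1 A)
    (hA0 : fundamentalVector A (γ 0) = velocity (F := F) γ 0) {θ : ℝ → G} (hθ0 : θ 0 = 1)
    (hθ' : ContMDiff 𝓘(ℝ, ℝ) 𝓘(ℝ, E) 1 θ)
    (hθ : IsMIntegralCurve (I := 𝓘(ℝ, E)) θ (mulInvariantVectorField A)) :
    θ (-1) • γ 1 = γ 0 := by
  have := hM.t2Space
  have : IsManifold 𝓘(ℝ, F) 1 (G ⧸ H) := .of_le (n := ∞) (by simp)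
  have h := eq_of_hasMFDerivWithinAt_zero (E := F) (δ := fun t => θ (-t) • γ t) fun t ht => by
    have h1 := hasMFDerivWithinAt_velocity
      (contMDiffOn_smul_curve hM hθ' contDiff_neg hγ.contMDiffOn) ht
    rw [velocity_smul hM hθ contDiff_neg hγ.contMDiffOn ht,
      hγ.velocity_eq_fundamentalVector hM hbi hind hA hA0 ht] at h1
    simp only [deriv_neg, neg_smul, one_smul, add_neg_cancel, map_zero] at h1
    refine h1.congr_mfderiv ?_
    exact ContinuousLinearMap.toSpanSingleton_zero ℝ
  simpa [hθ0] using h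

omit [IsContMDiffRiemannianBundle 𝓘(ℝ, F) ∞ F (fun p : G ⧸ H => TangentSpace 𝓘(ℝ, F) p)] in
/-- The orbit `t ↦ θ (-t) • p` of a one-parameter subgroup with initial velocity `-X`, when it has
the right length. -/
theorem isMinGeodesic_smul (hM : IsHomogeneousSpace (E := E) (F := F) H)
    (hbi : IsBiInvariant (E := E) G) (hind : IsInducedMetric (E := E) (F := F) H)
    {p : G ⧸ H} {A : GroupLieAlgebra 𝓘(ℝ, E) G} {θ : ℝ → G} (hθ0 : θ 0 = 1)
    (hθ' : ContMDiff 𝓘(ℝ, ℝ) 𝓘(ℝ, E) 1 θ)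
    (hθ : IsMIntegralCurve (I := 𝓘(ℝ, E)) θ (mulInvariantVectorField A))
    (hd : riemannianEDist 𝓘(ℝ, F) p (θ (-1) • p) =
      ‖(fundamentalVector A p : TangentSpace 𝓘(ℝ, F) p)‖ₑ) :
    IsMinGeodesic (fun t => θ (-t) • p) p (θ (-1) • p)
      (-fundamentalVector A p : TangentSpace 𝓘(ℝ, F) p) := by
  have hc : ContMDiffOn 𝓘(ℝ, ℝ) 𝓘(ℝ, F) 1 (fun _ : ℝ => p) (Icc 0 1) := contMDiffOn_const
  have hv : ∀ t ∈ Icc (0 : ℝ) 1, velocity (F := F) (fun t => θ (-t) • p) t =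
      mfderiv 𝓘(ℝ, F) 𝓘(ℝ, F) (fun y : G ⧸ H => θ (-t) • y) p (-fundamentalVector A p) := by
    intro t ht
    rw [velocity_smul hM hθ contDiff_neg hc ht]
    have h1 : velocity (F := F) (fun _ : ℝ => p) t = 0 := by
      rw [velocity, mfderivWithin_const]
      rfl
    rw [h1]
    simp
  have hs : ∀ t ∈ Icc (0 : ℝ) 1, ‖velocity (F := F) (fun t => θ (-t) • p) t‖ =
      ‖(-fundamentalVector A p : TangentSpace 𝓘(ℝ, F) p)‖ := fun t ht => by
    rw [hv t ht, hM.norm_smul hbi hind]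
  refine ⟨contMDiffOn_smul_curve hM hθ' contDiff_neg hc, ?_, rfl, hs, ?_⟩
  · have h1 := hv 0 (left_mem_Icc.2 zero_le_one)
    -- The comparison takes place in the tangent bundle, as the starting point is `p` only after `θ
    -- 0 = 1` is used; the tangent map is then that of the identity.
    have h2 : (⟨θ (-0) • p, velocity (F := F) (fun t => θ (-t) • p) 0⟩ :
        TangentBundle 𝓘(ℝ, F) (G ⧸ H)) =
        tangentMap 𝓘(ℝ, F) 𝓘(ℝ, F) (fun y : G ⧸ H => θ (-0) • y) ⟨p, -fundamentalVector A p⟩ := by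
      rw [h1]
      rfl
    refine h2.trans ?_
    have h3 : (fun y : G ⧸ H => θ (-0) • y) = id := by
      funext y
      rw [neg_zero, hθ0, one_smul, id]
    rw [h3, tangentMap_id, id]
  · rw [hd, pathELength_eq_lintegral_mfderivWithin_Icc, MeasureTheory.setLIntegral_congr_fun
      (g := fun _ => ‖(fundamentalVector A p : TangentSpace 𝓘(ℝ, F) p)‖ₑ) measurableSet_Icc]
    · simp
    · intro t ht
      rw [enorm_eq_iff_norm_eq, ← norm_neg (fundamentalVector A p)]
      exact hs t ht

end Geodesic

end HomSpace

/-! ### The main theorem -/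

theorem lemma3p4 {𝕜 : Type*} [RCLike 𝕜] {n : ℕ} (G : Subgroup (GL (Fin n) 𝕜))
    {E : Type*} [NormedAddCommGroup E] [NormedSpace ℝ E] [FiniteDimensional ℝ E]
    [ChartedSpace E G] [LieGroup 𝓘(ℝ, E) ∞ G] (hG : HomSpace.IsMatrixLieGroup G E)
    [RiemannianBundle (fun g : G => TangentSpace 𝓘(ℝ, E) g)]
    [IsContMDiffRiemannianBundle 𝓘(ℝ, E) ∞ E (fun g : G => TangentSpace 𝓘(ℝ, E) g)]
    (hbi : HomSpace.IsBiInvariant (E := E) G)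
    (H : Subgroup G)
    {F : Type*} [NormedAddCommGroup F] [NormedSpace ℝ F] [FiniteDimensional ℝ F]
    [ChartedSpace F (G ⧸ H)] [IsManifold 𝓘(ℝ, F) ∞ (G ⧸ H)]
    (hM : HomSpace.IsHomogeneousSpace (E := E) (F := F) H)
    [RiemannianBundle (fun p : G ⧸ H => TangentSpace 𝓘(ℝ, F) p)]
    [IsContMDiffRiemannianBundle 𝓘(ℝ, F) ∞ F (fun p : G ⧸ H => TangentSpace 𝓘(ℝ, F) p)]
    (hind : HomSpace.IsInducedMetric (E := E) (F := F) H) :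
    (∀ (Φ : G) (p q : G ⧸ H),
      riemannianEDist 𝓘(ℝ, F) (Φ • p) (Φ • q) ≤ riemannianEDist 𝓘(ℝ, F) p q) ∧
    (∀ (Φ : G) (p q : G ⧸ H) (X : TangentSpace 𝓘(ℝ, F) p), HomSpace.IsRiemLog p q X →
      ∃ A : GroupLieAlgebra 𝓘(ℝ, E) G,
        HomSpace.IsHorizontal (F := F) (fun g : G => g • p) 1 A ∧
        (⟨(1 : G) • p, mfderiv 𝓘(ℝ, E) 𝓘(ℝ, F) (fun g : G => g • p) 1 A⟩ :
          TangentBundle 𝓘(ℝ, F) (G ⧸ H)) = ⟨p, X⟩ ∧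
        ∃ k : G, (k : GL (Fin n) 𝕜).val = NormedSpace.exp (-HomSpace.lieMatrix A) ∧
          HomSpace.IsRiemLog p (k • p) (-X) ∧
          riemannianEDist 𝓘(ℝ, F) (Φ • p) (Φ • q) =
            riemannianEDist 𝓘(ℝ, F) (Φ • p) (Φ • (k • p))) := by
  have hT : T2Space G := inferInstance
  refine ⟨fun Φ p q => HomSpace.riemannianEDist_smul_le hM hbi hind Φ p q, ?_⟩
  rintro Φ p q X ⟨γ, hγ⟩
  have hi := hγ.initial
  have hf := hγ.final
  have hp : γ 0 = p := congrArg TotalSpace.proj hi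
  subst hp hf
  have hX : HomSpace.velocity (F := F) γ 0 = X := eq_of_heq (TotalSpace.mk.inj hi).2
  obtain ⟨A, hA, hAX⟩ := hM.exists_fundamentalVector_eq (γ 0) X
  obtain ⟨θ, hθ0, hθ', hθ⟩ := HomSpace.exists_integralCurve_mulInvariantVectorField A
  have hk : θ (-1) • γ 1 = γ 0 :=
    hγ.smul_final_eq_initial hM hbi hind hA (hAX.trans hX.symm) hθ0 hθ' hθ
  have hd : riemannianEDist 𝓘(ℝ, F) (γ 0) (θ (-1) • γ 0) =
      riemannianEDist 𝓘(ℝ, F) (γ 0) (γ 1) := by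
    -- Only the first `γ 0` becomes `θ (-1) • γ 1`, so that both points are translated by the same
    -- isometry.
    conv_lhs => enter [2]; rw [← hk]
    rw [HomSpace.riemannianEDist_smul hM hbi hind, riemannianEDist_comm]
  have hdX : riemannianEDist 𝓘(ℝ, F) (γ 0) (γ 1) = ‖X‖ₑ := by
    rw [← hγ.length, pathELength_eq_lintegral_mfderivWithin_Icc,
      MeasureTheory.setLIntegral_congr_fun (g := fun _ => ‖X‖ₑ) measurableSet_Icc]
    · simp
    · intro t ht
      rw [enorm_eq_iff_norm_eq]
      exact hγ.speed t ht
  -- The group element is `θ (-1)`, whose matrix is the exponential of `-A`.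
  refine ⟨A, hA, ?_, θ (-1), ?_, ⟨fun t => θ (-t) • γ 0, ?_⟩, ?_⟩
  · rw [← hAX]
    have h : ∀ y : G ⧸ H, y = γ 0 → ∀ u : F,
        (⟨y, u⟩ : TangentBundle 𝓘(ℝ, F) (G ⧸ H)) = ⟨γ 0, u⟩ := by
      rintro y rfl u; rfl
    exact h _ (one_smul G _) _
  · rw [hG.val_integralCurve hθ0 hθ, neg_smul, one_smul]
  · rw [← hAX] at hdX ⊢
    exact HomSpace.isMinGeodesic_smul hM hbi hind hθ0 hθ' hθ (hd.trans hdX)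
  · rw [HomSpace.riemannianEDist_smul hM hbi hind, HomSpace.riemannianEDist_smul hM hbi hind, hd]
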